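/- Let $K$ be a field containing an element of multiplicative order $6$, and let $G=\mathrm{A}_4\times \mathrm{C}_2$ be the direct product of the alternating group of degree $4$ and the group of order $2$. For a finite dimensional $KG$-module $V$ let $K[V]^G$ be the algebra of $G$-invariants in the polynomial ring $K[V]=K[x_1,\dots,x_n]$ on the coordinate functions of $V$. Let $\beta(G,V)$ be the minimal positive integer $d$ such that $K[V]^G$ is generated as a $K$-algebra by elements of degree at most $d$, and let $\beta_{\mathrm{sep}}(G,V)$ be the minimal positive integer $d$ such that for all $v,w\in V$ with $G\cdot v\neq G\cdot w$ there is an $f\in K[V]^G$ of degree at most $d$ with $f(v)\neq f(w)$. Let the Noether number $\beta^K(G)$ and the separating Noether number $\beta_{\mathrm{sep}}^K(G)$ be the suprema of $\beta(G,V)$ and of $\beta_{\mathrm{sep}}(G,V)$, respectively, over all finite dimensional $KG$-modules $V$. Then $$\beta_{\mathrm{sep}}^K(\mathrm{A}_4\times \mathrm{C}_2)=6\qquad\text{and}\qquad \beta^K(\mathrm{A}_4\times \mathrm{C}_2)=8.$$ -/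

import Mathlib

open scoped Matrix

noncomputable section

namespace InvariantTheory

variable {K : Type*} [Field K] {G : Type*} [Group G] {n : ℕ}

/-- A `KG`-module structure on the space `K ^ n` of column vectors is a homomorphism
`ρ : G →* GL (Fin n) K`; every `n`-dimensional `KG`-module is isomorphic to one of these.
The coordinate ring `K[V]` is the polynomial ring `K[x₁, …, xₙ]`, on which `G` acts through
`K`-algebra automorphisms with `g · x_j = ∑ i, ρ(g⁻¹)_{j i} x_i`, that is,
`(g · f)(v) = f(g⁻¹ · v)`. -/
def polyAction (ρ : G →* GL (Fin n) K) (g : G) :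
    MvPolynomial (Fin n) K →ₐ[K] MvPolynomial (Fin n) K :=
  MvPolynomial.aeval fun j =>
    ∑ i, MvPolynomial.C ((ρ g⁻¹ : Matrix (Fin n) (Fin n) K) j i) * MvPolynomial.X i

/-- The algebra `K[V]^G` of polynomial invariants. -/
def invariants (ρ : G →* GL (Fin n) K) : Subalgebra K (MvPolynomial (Fin n) K) where
  carrier := {f | ∀ g : G, polyAction ρ g f = f}
  mul_mem' hf hh g := by rw [map_mul, hf g, hh g]
  add_mem' hf hh g := by rw [map_add, hf g, hh g]
  algebraMap_mem' r g := (polyAction ρ g).commutes r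

/-- The set `K[V]^G_{≤ d}` of invariants of degree at most `d`. -/
def invariantsLE (ρ : G →* GL (Fin n) K) (d : ℕ) : Set (MvPolynomial (Fin n) K) :=
  {f | f ∈ invariants ρ ∧ f.totalDegree ≤ d}

/-- The orbit `G · v` of a vector `v` of `V = K ^ n`. -/
def orbit (ρ : G →* GL (Fin n) K) (v : Fin n → K) : Set (Fin n → K) :=
  Set.range fun g : G => (ρ g : Matrix (Fin n) (Fin n) K) *ᵥ v

/-- `S` separates the orbits: if `G · v ≠ G · w`, then some `f ∈ S` has `f(v) ≠ f(w)`. -/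
def IsSeparating (ρ : G →* GL (Fin n) K) (S : Set (MvPolynomial (Fin n) K)) : Prop :=
  ∀ v w : Fin n → K, orbit ρ v ≠ orbit ρ w →
    ∃ f ∈ S, MvPolynomial.eval v f ≠ MvPolynomial.eval w f

/-- `β(G, V)`: the minimal positive integer `d` such that `K[V]^G` is generated as a
`K`-algebra by its elements of degree at most `d` (`⊤` if there is no such `d`). -/
def betaRep (ρ : G →* GL (Fin n) K) : ℕ∞ :=
  ⨅ (d : ℕ) (_ : 0 < d ∧ Algebra.adjoin K (invariantsLE ρ d) = invariants ρ), (d : ℕ∞)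

/-- `β_sep(G, V)`: the minimal positive integer `d` such that the invariants of degree at
most `d` form a separating set (`⊤` if there is no such `d`). -/
def betaSepRep (ρ : G →* GL (Fin n) K) : ℕ∞ :=
  ⨅ (d : ℕ) (_ : 0 < d ∧ IsSeparating ρ (invariantsLE ρ d)), (d : ℕ∞)

variable (K G)

/-- The Noether number `β^K(G)`: the supremum of `β(G, V)` over all finite dimensional
`KG`-modules `V`. -/
def noetherNumber : ℕ∞ :=
  ⨆ (m : ℕ) (ρ : G →* GL (Fin m) K), betaRep ρ

/-- The separating Noether number `β_sep^K(G)`: the supremum of `β_sep(G, V)` over all finite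
dimensional `KG`-modules `V`. -/
def sepNoetherNumber : ℕ∞ :=
  ⨆ (m : ℕ) (ρ : G →* GL (Fin m) K), betaSepRep ρ

end InvariantTheory

end

noncomputable section

namespace InvariantTheory

open MvPolynomial

/-! ### The action on polynomials and its effect on values and degrees. -/

section Action

variable {K : Type*} [Field K] {G : Type*} [Group G] {n : ℕ}

/-! The group is the wreath product of `C₂` with `C₃`: three commuting involutions permuted
cyclically by an element `rot` of order 3. An element of order 6 in `K` makes 2 and 3 invertible and
provides a primitive cube root of unity `ω`. Linear forms therefore split into weight vectors for
the involutions, with weights in `F₂³`, and `rot` shifts weights cyclically.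

Noether number, upper bound. Invariants are spanned by the transfers `rotSum` of zero-weight
products of forms. If such a product splits into four zero-weight factors, `six_mul_trace_mul`
writes its transfer through transfers of lower degree. The Davenport constant of `F₂³` is 4, and
counting shows that every product of degree at least 9 splits in this way, except a short
zero-weight factor times forms of all seven nonzero weights; there, rotating part of the product
creates a splitting (`rotSum_mem_of_all_weights`).

Separating number, upper bound. Let `a`, `b` agree on invariants of degree at most 6. Suppose first
that a quadratic invariant `u` of the involutions, with `rot`-eigenvalue a primitive cube root of
unity, is nonzero at `a`. As `u³` is invariant, `b` can be rotated so that `u(a) = u(b)`; then all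
quadratic invariants of the involutions agree, and the forms of each weight `χ` change from `a` to
`b` by a sign `η χ`. The points are in one orbit once `η` is linear on the weights not vanishing at
`a`, and this is tested on zero-sum sets of at most four weights
(`sign_sum_eq_zero_of_eigenvector`). If no such `u` exists, the quadratic invariants take equal
values at `a`, its rotations and `b`, and one cubic transfer picks the rotation of `a` to compare
with `b` (`exists_mulVec_eq_of_agree`).

Lower bounds. Both use the sum of the signed permutation module on `x₀, x₁, x₂` and a character of
order 6 on `x₃`. On the `x₃`-axis invariants are polynomials in `x₃⁶`. An invariant of degree 8 is
shown to be indecomposable by restriction to a curve. -/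

theorem polyAction_X (ρ : G →* GL (Fin n) K) (g : G) (j : Fin n) :
    polyAction ρ g (X j) =
      ∑ i, C ((ρ g⁻¹ : Matrix (Fin n) (Fin n) K) j i) * X i := by
  simp [polyAction]

theorem eval_polyAction (ρ : G →* GL (Fin n) K) (g : G) (v : Fin n → K)
    (f : MvPolynomial (Fin n) K) :
    eval v (polyAction ρ g f) = eval ((ρ g⁻¹ : Matrix (Fin n) (Fin n) K) *ᵥ v) f := by
  have : (aeval v : MvPolynomial (Fin n) K →ₐ[K] K).comp (polyAction ρ g) =
      aeval ((ρ g⁻¹ : Matrix (Fin n) (Fin n) K) *ᵥ v) := by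
    ext j
    simp [polyAction_X, Matrix.mulVec, dotProduct]
  have h := DFunLike.congr_fun this f
  simpa [coe_aeval_eq_eval] using h

theorem polyAction_mul (ρ : G →* GL (Fin n) K) (g h : G) (f : MvPolynomial (Fin n) K) :
    polyAction ρ (g * h) f = polyAction ρ g (polyAction ρ h f) := by
  have : polyAction ρ (g * h) = (polyAction ρ g).comp (polyAction ρ h) := by
    ext1 j
    simp only [AlgHom.comp_apply, polyAction_X, map_sum, map_mul, mul_inv_rev]
    simp only [algHom_C, algebraMap_eq, Units.val_mul, Matrix.mul_apply,
      Finset.mul_sum, Finset.sum_mul, map_sum, map_mul]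
    rw [Finset.sum_comm]
    simp [mul_assoc]
  rw [this]; rfl

theorem polyAction_one (ρ : G →* GL (Fin n) K) (f : MvPolynomial (Fin n) K) :
    polyAction ρ 1 f = f := by
  have : polyAction ρ 1 = AlgHom.id K _ := by
    ext1 j
    simp [polyAction_X, Matrix.one_apply, Finset.sum_ite_eq]
  rw [this]; rfl

theorem totalDegree_polyAction_le (ρ : G →* GL (Fin n) K) (g : G)
    (f : MvPolynomial (Fin n) K) : (polyAction ρ g f).totalDegree ≤ f.totalDegree := by
  have hX (j : Fin n) : (polyAction ρ g (X j)).totalDegree ≤ 1 := by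
    rw [polyAction_X]
    refine (totalDegree_finsetSum _ _).trans (Finset.sup_le fun i _ => ?_)
    refine (totalDegree_mul _ _).trans ?_
    simp
  conv_lhs => rw [f.as_sum, map_sum]
  refine (totalDegree_finsetSum _ _).trans (Finset.sup_le fun s hs => ?_)
  rw [monomial_eq, map_mul, Finsupp.prod, map_prod]
  refine (totalDegree_mul _ _).trans ?_
  simp only [algHom_C, algebraMap_eq, totalDegree_C, zero_add, map_pow]
  refine (totalDegree_finsetProd _ _).trans ?_
  refine le_trans ?_ (le_totalDegree hs)
  refine Finset.sum_le_sum fun i _ => ?_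
  refine (totalDegree_pow _ _).trans ?_
  simpa using Nat.mul_le_mul_left (s i) (hX i)

end Action

/-! ### The wreath product structure and the weights of the involutions. -/

/-- Generators of a group isomorphic to the wreath product of `C₂` with `C₃`: commuting
involutions permuted cyclically by an element of order `3`. -/
structure WreathGenerators (G : Type*) [Group G] where
  /-- the involutions -/
  inv : Fin 3 → G
  /-- the element of order `3` -/
  rot : G
  inv_mul_self : ∀ i, inv i * inv i = 1
  inv_comm : ∀ i j, inv i * inv j = inv j * inv i
  rot_cube : rot * (rot * rot) = 1
  rot_mul_inv : ∀ i, rot * inv i = inv (i + 1) * rot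
  closure_eq_top : Subgroup.closure (insert rot (Set.range inv)) = ⊤

/-- The character `ZMod 2 → {1, -1} ⊆ K`. -/
def sgn (K : Type*) [Field K] (a : ZMod 2) : K := if a = 0 then 1 else -1

section Sgn

variable {K : Type*} [Field K]

@[simp] theorem sgn_zero : sgn K 0 = 1 := by simp [sgn]

@[simp] theorem sgn_one : sgn K 1 = -1 := by simp [sgn]

theorem zmod_two_cases : ∀ a : ZMod 2, a = 0 ∨ a = 1 := by decide

theorem sgn_add (a b : ZMod 2) : sgn K (a + b) = sgn K a * sgn K b := by
  have h2 : (1 + 1 : ZMod 2) = 0 := by decide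
  rcases zmod_two_cases a with rfl | rfl <;> rcases zmod_two_cases b with rfl | rfl <;> simp [h2]

theorem sgn_mul_self (a : ZMod 2) : sgn K a * sgn K a = 1 := by
  rcases zmod_two_cases a with rfl | rfl <;> simp

theorem sgn_ne_zero (a : ZMod 2) : sgn K a ≠ 0 := by
  rcases zmod_two_cases a with rfl | rfl <;> simp

theorem sgn_sum {ι : Type*} (s : Finset ι) (f : ι → ZMod 2) :
    sgn K (∑ i ∈ s, f i) = ∏ i ∈ s, sgn K (f i) := by
  classical
  induction s using Finset.induction_on with
  | empty => simp
  | insert a s ha ih => rw [Finset.sum_insert ha, Finset.prod_insert ha, sgn_add, ih]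

theorem sgn_injective (h2 : (2 : K) ≠ 0) : Function.Injective (sgn K) := by
  intro a b h
  have h1 : (1 : K) ≠ -1 := fun h => h2 (by linear_combination h)
  rcases zmod_two_cases a with rfl | rfl <;> rcases zmod_two_cases b with rfl | rfl <;>
    simp only [sgn_zero, sgn_one] at h
  · rfl
  · exact absurd h h1
  · exact absurd h.symm h1
  · rfl

end Sgn

/-- The cyclic shift of a weight. -/
def shift (χ : Fin 3 → ZMod 2) : Fin 3 → ZMod 2 := fun i => χ (i - 1)

@[simp] theorem shift_zero : shift 0 = 0 := rfl

theorem shift_shift_shift (χ : Fin 3 → ZMod 2) : shift (shift (shift χ)) = χ := by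
  funext i
  simp only [shift]
  congr 1
  revert i; decide

/-! ### Weight spaces of polynomials and the transfer. -/

section Weights

variable {K : Type*} [Field K] {G : Type*} [Group G] {n : ℕ}
  (w : WreathGenerators G) (ρ : G →* GL (Fin n) K)

/-- Polynomials of degree at most `k` on which the involutions act through the character `χ`. -/
def weightLE (k : ℕ) (χ : Fin 3 → ZMod 2) : Submodule K (MvPolynomial (Fin n) K) where
  carrier := {f | f.totalDegree ≤ k ∧ ∀ i, polyAction ρ (w.inv i) f = sgn K (χ i) • f}
  zero_mem' := by simp
  add_mem' {f h} hf hh := by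
    refine ⟨(totalDegree_add _ _).trans (max_le hf.1 hh.1), fun i => ?_⟩
    rw [map_add, hf.2, hh.2, smul_add]
  smul_mem' c f hf := by
    refine ⟨(totalDegree_smul_le _ _).trans hf.1, fun i => ?_⟩
    rw [map_smul, hf.2, smul_comm]

variable {w ρ}

theorem weightLE.mul {k l : ℕ} {χ ψ : Fin 3 → ZMod 2} {f h : MvPolynomial (Fin n) K}
    (hf : f ∈ weightLE w ρ k χ) (hh : h ∈ weightLE w ρ l ψ) :
    f * h ∈ weightLE w ρ (k + l) (χ + ψ) := by
  refine ⟨(totalDegree_mul _ _).trans (add_le_add hf.1 hh.1), fun i => ?_⟩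
  rw [map_mul, hf.2, hh.2, smul_mul_smul_comm, Pi.add_apply, sgn_add]

theorem weightLE.one : (1 : MvPolynomial (Fin n) K) ∈ weightLE w ρ 0 0 :=
  ⟨by simp, fun i => by simp⟩

theorem weightLE.mono {k l : ℕ} {χ : Fin 3 → ZMod 2} {f : MvPolynomial (Fin n) K}
    (hf : f ∈ weightLE w ρ k χ) (hkl : k ≤ l) : f ∈ weightLE w ρ l χ :=
  ⟨hf.1.trans hkl, hf.2⟩

theorem weightLE.prod {ι : Type*} {s : Finset ι} {χ : ι → Fin 3 → ZMod 2}
    {f : ι → MvPolynomial (Fin n) K} (hf : ∀ i ∈ s, f i ∈ weightLE w ρ 1 (χ i)) :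
    ∏ i ∈ s, f i ∈ weightLE w ρ s.card (∑ i ∈ s, χ i) := by
  classical
  induction s using Finset.induction_on with
  | empty => simpa using weightLE.one
  | insert a s ha ih =>
    rw [Finset.prod_insert ha, Finset.sum_insert ha, Finset.card_insert_of_notMem ha, add_comm _ 1]
    exact weightLE.mul (hf a (by simp)) (ih fun i hi => hf i (by simp [hi]))

/-- The relation `rot * inv (i - 1) = inv i * rot` turns the action of the `i`-th involution after
rotation into that of the previous one before it. -/
theorem weightLE.rot {k : ℕ} {χ : Fin 3 → ZMod 2} {f : MvPolynomial (Fin n) K}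
    (hf : f ∈ weightLE w ρ k χ) : polyAction ρ w.rot f ∈ weightLE w ρ k (shift χ) := by
  refine ⟨(totalDegree_polyAction_le _ _ _).trans hf.1, fun i => ?_⟩
  have h := w.rot_mul_inv (i - 1)
  rw [sub_add_cancel] at h
  rw [← polyAction_mul, ← h, polyAction_mul, hf.2, map_smul]
  rfl

theorem weightLE.rot_zero {k : ℕ} {f : MvPolynomial (Fin n) K}
    (hf : f ∈ weightLE w ρ k 0) : polyAction ρ w.rot f ∈ weightLE w ρ k 0 := by
  have h := weightLE.rot (χ := 0) hf
  rwa [shift_zero] at h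

theorem rot_rot_rot (f : MvPolynomial (Fin n) K) :
    polyAction ρ w.rot (polyAction ρ w.rot (polyAction ρ w.rot f)) = f := by
  rw [← polyAction_mul, ← polyAction_mul, mul_assoc, w.rot_cube, polyAction_one]

variable (w ρ)

/-- The transfer with respect to the element of order `3`. -/
def rotSum : MvPolynomial (Fin n) K →ₗ[K] MvPolynomial (Fin n) K :=
  LinearMap.id + (polyAction ρ w.rot).toLinearMap +
    (polyAction ρ w.rot).toLinearMap ∘ₗ (polyAction ρ w.rot).toLinearMap

theorem rotSum_apply (f : MvPolynomial (Fin n) K) :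
    rotSum w ρ f = f + polyAction ρ w.rot f + polyAction ρ w.rot (polyAction ρ w.rot f) := rfl

variable {w ρ}

theorem mem_invariants_of_generators {f : MvPolynomial (Fin n) K}
    (h1 : ∀ i, polyAction ρ (w.inv i) f = f) (h2 : polyAction ρ w.rot f = f) :
    f ∈ invariants ρ := by
  let H : Subgroup G :=
    { carrier := {g | polyAction ρ g f = f}
      one_mem' := polyAction_one ρ f
      mul_mem' := fun {a b} ha hb => by
        change polyAction ρ (a * b) f = f
        rw [polyAction_mul, hb, ha]
      inv_mem' := fun {a} ha => by
        change polyAction ρ a⁻¹ f = f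
        conv_lhs => rw [← show polyAction ρ a f = f from ha]
        rw [← polyAction_mul, inv_mul_cancel, polyAction_one] }
  have hH : Subgroup.closure (insert w.rot (Set.range w.inv)) ≤ H := by
    rw [Subgroup.closure_le]
    rintro x (rfl | ⟨i, rfl⟩)
    exacts [h2, h1 i]
  rw [w.closure_eq_top] at hH
  exact fun g => hH (Subgroup.mem_top g)

theorem mem_invariantsLE {k : ℕ} {f : MvPolynomial (Fin n) K} (hf : f ∈ weightLE w ρ k 0)
    (hr : polyAction ρ w.rot f = f) : f ∈ invariantsLE ρ k :=
  ⟨mem_invariants_of_generators (w := w) (fun i => by simpa using hf.2 i) hr, hf.1⟩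

theorem rotSum_mem {k : ℕ} {f : MvPolynomial (Fin n) K} (hf : f ∈ weightLE w ρ k 0) :
    rotSum w ρ f ∈ invariantsLE ρ k := by
  refine mem_invariantsLE (w := w) ?_ ?_
  · rw [rotSum_apply]
    have h1 := weightLE.rot_zero hf
    exact add_mem (add_mem hf h1) (weightLE.rot_zero h1)
  · rw [rotSum_apply, map_add, map_add, rot_rot_rot]
    ring

/-- Every polynomial is a sum of weight vectors of at most the same degree. -/
theorem mem_span_weightLE (h2 : (2 : K) ≠ 0) {f : MvPolynomial (Fin n) K} {k : ℕ}
    (hf : f.totalDegree ≤ k) :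
    f ∈ Submodule.span K (⋃ χ, (weightLE w ρ k χ : Set (MvPolynomial (Fin n) K))) := by
  -- `e i a` projects onto the `sgn a`-eigenspace of the `i`-th involution. The involutions commute,
  -- so composing the three projections yields a weight vector.
  let e (i : Fin 3) (a : ZMod 2) (p : MvPolynomial (Fin n) K) : MvPolynomial (Fin n) K :=
    (2⁻¹ : K) • (p + sgn K a • polyAction ρ (w.inv i) p)
  have hsum (i p) : p = e i 0 p + e i 1 p := by
    simp only [e, sgn_zero, sgn_one, ← smul_add]
    rw [show p + (1 : K) • polyAction ρ (w.inv i) p + (p + (-1 : K) • polyAction ρ (w.inv i) p) =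
      (2 : K) • p by rw [two_smul, one_smul, neg_one_smul]; ring, smul_smul,
      inv_mul_cancel₀ h2, one_smul]
  have hself (i a p) : polyAction ρ (w.inv i) (e i a p) = sgn K a • e i a p := by
    simp only [e, map_smul, map_add]
    rw [← polyAction_mul, w.inv_mul_self, polyAction_one, smul_comm]
    congr 1
    rw [smul_add, smul_smul, sgn_mul_self, one_smul, add_comm]
  have hcomm (i j a p) (c : K) (hp : polyAction ρ (w.inv j) p = c • p) :
      polyAction ρ (w.inv j) (e i a p) = c • e i a p := by
    simp only [e, map_smul, map_add]
    rw [← polyAction_mul, w.inv_comm, polyAction_mul, hp, map_smul]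
    simp only [smul_add, smul_smul]
    congr 2 <;> ring_nf
  have hdeg (i a) (p : MvPolynomial (Fin n) K) (hp : p.totalDegree ≤ k) :
      (e i a p).totalDegree ≤ k := by
    refine (totalDegree_smul_le _ _).trans ((totalDegree_add _ _).trans (max_le hp ?_))
    exact (totalDegree_smul_le _ _).trans ((totalDegree_polyAction_le _ _ _).trans hp)
  have key (a b c) : e 2 c (e 1 b (e 0 a f)) ∈
      Submodule.span K (⋃ χ, (weightLE w ρ k χ : Set (MvPolynomial (Fin n) K))) := by
    refine Submodule.subset_span (Set.mem_iUnion.2 ⟨![a, b, c], hdeg _ _ _ (hdeg _ _ _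
      (hdeg _ _ _ hf)), fun i => ?_⟩)
    fin_cases i
    · exact hcomm _ _ _ _ _ (hcomm _ _ _ _ _ (hself _ _ _))
    · exact hcomm _ _ _ _ _ (hself _ _ _)
    · exact hself _ _ _
  rw [hsum 0 f, hsum 1 (e 0 0 f), hsum 1 (e 0 1 f), hsum 2 (e 1 0 (e 0 0 f)),
    hsum 2 (e 1 1 (e 0 0 f)), hsum 2 (e 1 0 (e 0 1 f)), hsum 2 (e 1 1 (e 0 1 f))]
  exact add_mem (add_mem (add_mem (key _ _ _) (key _ _ _)) (add_mem (key _ _ _) (key _ _ _)))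
    (add_mem (add_mem (key _ _ _) (key _ _ _)) (add_mem (key _ _ _) (key _ _ _)))

end Weights

/-! ### Short zero-sum subsequences in `F₂³`. -/

section ZeroSum

variable {ι : Type*} [DecidableEq ι]

theorem zmod_two_add_self {α : Type*} (f : α → ZMod 2) : f + f = 0 := by
  funext i
  exact CharTwo.add_self_eq_zero _

/-- Four indices have 16 subsets but there are only 8 weights, so two subsets have equal sums; in
characteristic 2 their symmetric difference has sum zero. -/
theorem exists_zeroSum_of_four_le_card (χ : ι → Fin 3 → ZMod 2) (s : Finset ι)
    (hs : 4 ≤ s.card) : ∃ t ⊆ s, t.Nonempty ∧ t.card ≤ 4 ∧ ∑ i ∈ t, χ i = 0 := by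
  obtain ⟨u, hus, hu⟩ := Finset.exists_subset_card_eq hs
  obtain ⟨a, ha, b, hb, hab, hsum⟩ := Finset.exists_ne_map_eq_of_card_lt_of_maps_to
    (s := u.powerset) (t := (Finset.univ : Finset (Fin 3 → ZMod 2)))
    (by rw [Finset.card_powerset, hu]; decide) (f := fun t => ∑ i ∈ t, χ i) (by simp [Set.MapsTo])
  rw [Finset.mem_powerset] at ha hb
  refine ⟨symmDiff a b, ?_, ?_, ?_, ?_⟩
  · exact (Finset.union_subset (Finset.sdiff_subset.trans ha)
      (Finset.sdiff_subset.trans hb)).trans hus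
  · rw [Finset.nonempty_iff_ne_empty]
    intro h
    exact hab (symmDiff_eq_bot.1 h)
  · rw [← hu]
    exact Finset.card_le_card (Finset.union_subset (Finset.sdiff_subset.trans ha)
      (Finset.sdiff_subset.trans hb))
  · have h1 := Finset.sum_inter_add_sum_sdiff a b χ
    have h2 := Finset.sum_inter_add_sum_sdiff b a χ
    have h3 : ∑ i ∈ symmDiff a b, χ i = ∑ i ∈ a \ b, χ i + ∑ i ∈ b \ a, χ i := by
      rw [← Finset.sum_union disjoint_sdiff_sdiff]; rfl
    rw [Finset.inter_comm b a, ← hsum, ← h1] at h2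
    rw [h3, add_left_cancel h2, zmod_two_add_self]

theorem sum_sdiff_eq_zero {χ : ι → Fin 3 → ZMod 2} {s t : Finset ι} (hts : t ⊆ s)
    (hs : ∑ i ∈ s, χ i = 0) (ht : ∑ i ∈ t, χ i = 0) : ∑ i ∈ s \ t, χ i = 0 := by
  have h := Finset.sum_sdiff (f := χ) hts
  rwa [hs, ht, add_zero] at h

/-- Either a weight is zero, or two of the eight coincide among the seven nonzero ones. -/
theorem exists_zeroSum_of_eight_le_card (χ : ι → Fin 3 → ZMod 2) (s : Finset ι)
    (hs : 8 ≤ s.card) : ∃ t ⊆ s, t.Nonempty ∧ t.card ≤ 2 ∧ ∑ i ∈ t, χ i = 0 := by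
  by_cases h0 : ∃ i ∈ s, χ i = 0
  · obtain ⟨i, hi, h⟩ := h0
    exact ⟨{i}, by simpa using hi, by simp, by simp, by simpa using h⟩
  push Not at h0
  obtain ⟨a, ha, b, hb, hab, h⟩ := Finset.exists_ne_map_eq_of_card_lt_of_maps_to
    (s := s) (t := (Finset.univ.erase 0 : Finset (Fin 3 → ZMod 2))) (f := χ)
    (lt_of_lt_of_le (by decide) hs) (fun i hi => by simpa using h0 i hi)
  refine ⟨{a, b}, by simp [Finset.insert_subset_iff, ha, hb], by simp, Finset.card_le_two, ?_⟩
  rw [Finset.sum_pair hab, h, zmod_two_add_self]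

/-- With seven terms the pigeonhole argument fails only when each nonzero weight occurs exactly
once. -/
theorem exists_zeroSum_or_bijOn (χ : ι → Fin 3 → ZMod 2) (s : Finset ι)
    (hs : 7 ≤ s.card) : (∃ t ⊆ s, t.Nonempty ∧ t.card ≤ 2 ∧ ∑ i ∈ t, χ i = 0) ∨
      Set.BijOn χ s (Finset.univ.erase 0 : Finset (Fin 3 → ZMod 2)) := by
  by_cases h0 : ∃ i ∈ s, χ i = 0
  · obtain ⟨i, hi, h⟩ := h0
    exact Or.inl ⟨{i}, by simpa using hi, by simp, by simp, by simpa using h⟩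
  push Not at h0
  by_cases hinj : Set.InjOn χ s
  · right
    have hm : Set.MapsTo χ s (Finset.univ.erase 0 : Finset (Fin 3 → ZMod 2)) :=
      fun i hi => by simpa using h0 i hi
    exact ⟨hm, hinj, Finset.surjOn_of_injOn_of_card_le _ hm hinj (le_trans (by decide) hs)⟩
  · left
    simp only [Set.InjOn] at hinj
    push Not at hinj
    obtain ⟨a, ha, b, hb, h, hab⟩ := hinj
    refine ⟨{a, b}, by simpa [Finset.insert_subset_iff] using ⟨ha, hb⟩, by simp,
      Finset.card_le_two, ?_⟩
    rw [Finset.sum_pair hab, h, zmod_two_add_self]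

end ZeroSum

/-! ### Generation of the invariants in degree at most 8. -/

/-- The polarized Cayley-Hamilton identity for the transfer of an automorphism of order `3`. -/
theorem six_mul_trace_mul {R : Type*} [CommRing R] (σ : R →+* R) (t : R → R)
    (ht : ∀ x, t x = x + σ x + σ (σ x)) (a b c d : R) :
    6 * t (a * b * c * d) =
      2 * (t a * t (b * c * d) + t b * t (a * c * d) + t c * t (a * b * d))
      - ((t a * t b - t (a * b)) * t (c * d) + (t a * t c - t (a * c)) * t (b * d)
        + (t b * t c - t (b * c)) * t (a * d))
      + (t a * t b * t c - t a * t (b * c) - t b * t (a * c) - t c * t (a * b)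
        + 2 * t (a * b * c)) * t d := by
  simp only [ht, map_mul]
  ring

section FormProduct

variable {K : Type*} [Field K] {G : Type*} [Group G] {n : ℕ}
  (w : WreathGenerators G) (ρ : G →* GL (Fin n) K)

/-- Products of `d` weight vectors of degree at most `1` with total weight `χ`. -/
def IsFormProduct (d : ℕ) (χ : Fin 3 → ZMod 2) (p : MvPolynomial (Fin n) K) : Prop :=
  ∃ l : List ((Fin 3 → ZMod 2) × MvPolynomial (Fin n) K),
    (∀ x ∈ l, x.2 ∈ weightLE w ρ 1 x.1) ∧ l.length = d ∧ (l.map Prod.fst).sum = χ ∧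
      (l.map Prod.snd).prod = p

variable {w ρ}

theorem IsFormProduct.mul {d e : ℕ} {χ ψ : Fin 3 → ZMod 2} {p q : MvPolynomial (Fin n) K}
    (hp : IsFormProduct w ρ d χ p) (hq : IsFormProduct w ρ e ψ q) :
    IsFormProduct w ρ (d + e) (χ + ψ) (p * q) := by
  obtain ⟨l, hl, rfl, rfl, rfl⟩ := hp
  obtain ⟨l', hl', rfl, rfl, rfl⟩ := hq
  refine ⟨l ++ l', fun x hx => ?_, by simp, by simp, by simp⟩
  rcases List.mem_append.1 hx with h | h
  exacts [hl x h, hl' x h]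

theorem IsFormProduct.mul_zero {d e : ℕ} {p q : MvPolynomial (Fin n) K}
    (hp : IsFormProduct w ρ d 0 p) (hq : IsFormProduct w ρ e 0 q) :
    IsFormProduct w ρ (d + e) 0 (p * q) := by
  simpa using hp.mul hq

theorem IsFormProduct.one : IsFormProduct w ρ 0 0 (1 : MvPolynomial (Fin n) K) :=
  ⟨[], by simp, rfl, rfl, rfl⟩

theorem IsFormProduct.of_mem {χ : Fin 3 → ZMod 2} {p : MvPolynomial (Fin n) K}
    (hp : p ∈ weightLE w ρ 1 χ) : IsFormProduct w ρ 1 χ p :=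
  ⟨[(χ, p)], by simpa using hp, rfl, by simp, by simp⟩

theorem IsFormProduct.prod {ι : Type*} {s : Finset ι} {χ : ι → Fin 3 → ZMod 2}
    {f : ι → MvPolynomial (Fin n) K} (hf : ∀ i ∈ s, f i ∈ weightLE w ρ 1 (χ i)) :
    IsFormProduct w ρ s.card (∑ i ∈ s, χ i) (∏ i ∈ s, f i) := by
  classical
  induction s using Finset.induction_on with
  | empty => simpa using IsFormProduct.one
  | insert a s ha ih =>
    rw [Finset.prod_insert ha, Finset.sum_insert ha, Finset.card_insert_of_notMem ha, add_comm _ 1]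
    exact (IsFormProduct.of_mem (hf a (by simp))).mul (ih fun i hi => hf i (by simp [hi]))

theorem IsFormProduct.exists_fin {d : ℕ} {χ : Fin 3 → ZMod 2} {p : MvPolynomial (Fin n) K}
    (hp : IsFormProduct w ρ d χ p) :
    ∃ (c : Fin d → Fin 3 → ZMod 2) (f : Fin d → MvPolynomial (Fin n) K),
      (∀ i, f i ∈ weightLE w ρ 1 (c i)) ∧ ∑ i, c i = χ ∧ ∏ i, f i = p := by
  obtain ⟨l, hl, rfl, rfl, rfl⟩ := hp
  exact ⟨fun i => (l[i]).1, fun i => (l[i]).2, fun i => hl _ (List.getElem_mem _),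
    Fin.sum_univ_fun_getElem l Prod.fst, Fin.prod_univ_fun_getElem l Prod.snd⟩

theorem IsFormProduct.mem_weightLE {d : ℕ} {χ : Fin 3 → ZMod 2} {p : MvPolynomial (Fin n) K}
    (hp : IsFormProduct w ρ d χ p) : p ∈ weightLE w ρ d χ := by
  obtain ⟨c, f, hf, rfl, rfl⟩ := hp.exists_fin
  simpa using weightLE.prod (s := Finset.univ) fun i _ => hf i

/-- Each variable is a sum of weight vectors of degree at most 1; monomials are expanded
accordingly. -/
theorem mem_span_isFormProduct (h2 : (2 : K) ≠ 0) (f : MvPolynomial (Fin n) K) :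
    f ∈ Submodule.span K {p | ∃ d χ, IsFormProduct w ρ d χ p} := by
  induction f using MvPolynomial.induction_on with
  | C a =>
    rw [← mul_one (C a), ← smul_eq_C_mul]
    exact Submodule.smul_mem _ _ (Submodule.subset_span ⟨0, 0, IsFormProduct.one⟩)
  | add p q hp hq => exact add_mem hp hq
  | mul_X p j hp =>
    have hX : (X j : MvPolynomial (Fin n) K) ∈ Submodule.span K
        {p | ∃ d χ, IsFormProduct w ρ d χ p} := by
      refine Submodule.span_mono ?_ (mem_span_weightLE (w := w) (ρ := ρ) h2 (totalDegree_X j).le)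
      intro p hp
      obtain ⟨χ, h⟩ := Set.mem_iUnion.1 hp
      exact ⟨1, χ, IsFormProduct.of_mem h⟩
    have h := Submodule.mul_mem_mul hp hX
    rw [Submodule.span_mul_span] at h
    refine Submodule.span_mono ?_ h
    rintro _ ⟨a, ⟨d, χ, ha⟩, b, ⟨e, ψ, hb⟩, rfl⟩
    exact ⟨_, _, ha.mul hb⟩

section Decomposition

variable {B : Subalgebra K (MvPolynomial (Fin n) K)} (h6 : (6 : K) ≠ 0) {d : ℕ}
  (ih : ∀ e < d, ∀ p, IsFormProduct w ρ e 0 p → rotSum w ρ p ∈ B)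

-- Every transfer on the right of `six_mul_trace_mul` involves at most three of the four factors,
-- hence has degree below `d` and is covered by `ih`; then 6 is cancelled.
include h6 ih in
theorem rotSum_mem_of_four {a b c e : ℕ} {p q r s : MvPolynomial (Fin n) K}
    (hp : IsFormProduct w ρ a 0 p) (hq : IsFormProduct w ρ b 0 q) (hr : IsFormProduct w ρ c 0 r)
    (hs : IsFormProduct w ρ e 0 s) (ha : 0 < a) (hb : 0 < b) (hc : 0 < c) (he : 0 < e)
    (hd : a + b + c + e ≤ d) : rotSum w ρ (p * q * r * s) ∈ B := by
  have key := six_mul_trace_mul (polyAction ρ w.rot).toRingHom (rotSum w ρ)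
    (rotSum_apply w ρ) p q r s
  have tp := ih _ (by omega) _ hp
  have tq := ih _ (by omega) _ hq
  have tr := ih _ (by omega) _ hr
  have ts := ih _ (by omega) _ hs
  have tpq := ih _ (by omega) _ (hp.mul_zero hq)
  have tpr := ih _ (by omega) _ (hp.mul_zero hr)
  have tqr := ih _ (by omega) _ (hq.mul_zero hr)
  have tps := ih _ (by omega) _ (hp.mul_zero hs)
  have tqs := ih _ (by omega) _ (hq.mul_zero hs)
  have trs := ih _ (by omega) _ (hr.mul_zero hs)
  have tpqr := ih _ (by omega) _ ((hp.mul_zero hq).mul_zero hr)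
  have tpqs := ih _ (by omega) _ ((hp.mul_zero hq).mul_zero hs)
  have tprs := ih _ (by omega) _ ((hp.mul_zero hr).mul_zero hs)
  have tqrs := ih _ (by omega) _ ((hq.mul_zero hr).mul_zero hs)
  have h2 : (2 : MvPolynomial (Fin n) K) ∈ B := ofNat_mem B 2
  have hmem : 6 * rotSum w ρ (p * q * r * s) ∈ B := by
    rw [key]
    refine add_mem (sub_mem (mul_mem h2 (add_mem (add_mem ?_ ?_) ?_))
      (add_mem (add_mem ?_ ?_) ?_)) (mul_mem (add_mem (sub_mem (sub_mem (sub_mem ?_ ?_) ?_) ?_) ?_) ?_)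
    · exact mul_mem tp tqrs
    · exact mul_mem tq tprs
    · exact mul_mem tr tpqs
    · exact mul_mem (sub_mem (mul_mem tp tq) tpq) trs
    · exact mul_mem (sub_mem (mul_mem tp tr) tpr) tqs
    · exact mul_mem (sub_mem (mul_mem tq tr) tqr) tps
    · exact mul_mem (mul_mem tp tq) tr
    · exact mul_mem tp tqr
    · exact mul_mem tq tpr
    · exact mul_mem tr tpq
    · exact mul_mem h2 tpqr
    · exact ts
  have h := B.smul_mem hmem (6 : K)⁻¹
  rwa [show (6 : MvPolynomial (Fin n) K) = C 6 from (map_ofNat C 6).symm, ← smul_eq_C_mul, smul_smul,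
    inv_mul_cancel₀ h6, one_smul] at h

-- With `σ` the rotation, `t(p) t(q) = t(pq) + t(σp · q) + t(σ²p · q)`. This trades a product that
-- does not split well for two in which only `p` has been rotated.
include ih in
theorem rotSum_mul_add_mem {a b : ℕ} {p q : MvPolynomial (Fin n) K}
    (hp : IsFormProduct w ρ a 0 p) (hq : IsFormProduct w ρ b 0 q) (ha : 0 < a) (hb : 0 < b)
    (hd : a + b ≤ d)
    (h1 : rotSum w ρ (polyAction ρ w.rot p * q) ∈ B)
    (h2 : rotSum w ρ (polyAction ρ w.rot (polyAction ρ w.rot p) * q) ∈ B) :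
    rotSum w ρ (p * q) ∈ B := by
  have h := sub_mem (sub_mem (mul_mem (ih _ (by omega) _ hp) (ih _ (by omega) _ hq)) h1) h2
  convert h using 1
  simp only [rotSum_apply, map_mul, rot_rot_rot]
  ring

include h6 ih in
/-- The case of a product containing each nonzero weight. -/
theorem rotSum_mem_of_all_weights {e : ℕ} {f : (Fin 3 → ZMod 2) → MvPolynomial (Fin n) K}
    (hf : ∀ χ, χ ≠ 0 → f χ ∈ weightLE w ρ 1 χ) {q : MvPolynomial (Fin n) K}
    (hq : IsFormProduct w ρ e 0 q) (he : 0 < e) (hd : e + 7 ≤ d) :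
    rotSum w ρ (q * ∏ χ ∈ Finset.univ.erase 0, f χ) ∈ B := by
  have hF (χ) (h : χ ≠ 0) := IsFormProduct.of_mem (hf χ h)
  have hg (χ) (h : χ ≠ 0) := IsFormProduct.of_mem (weightLE.rot (hf χ h))
  have hgg (χ) (h : χ ≠ 0) := IsFormProduct.of_mem (weightLE.rot (weightLE.rot (hf χ h)))
  have hprod : ∏ χ ∈ Finset.univ.erase 0, f χ = (f ![1, 0, 0] * f ![0, 1, 1] * f ![1, 1, 1]) *
      (f ![0, 1, 0] * f ![0, 0, 1] * f ![1, 0, 1] * f ![1, 1, 0]) := by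
    rw [show (Finset.univ.erase 0 : Finset (Fin 3 → ZMod 2)) = {![1, 0, 0], ![0, 1, 1], ![1, 1, 1],
      ![0, 1, 0], ![0, 0, 1], ![1, 0, 1], ![1, 1, 0]} by decide]
    iterate 6 rw [Finset.prod_insert (by decide)]
    rw [Finset.prod_singleton]
    ring
  have hzero {k χ} {p : MvPolynomial (Fin n) K} (hp : IsFormProduct w ρ k χ p) (h : χ = 0) :
      IsFormProduct w ρ k 0 p := h ▸ hp
  have x0 := hF ![1, 0, 0] (by decide)
  have x1 := hF ![0, 1, 0] (by decide)
  have x2 := hF ![0, 0, 1] (by decide)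
  have y0 := hF ![0, 1, 1] (by decide)
  have y1 := hF ![1, 0, 1] (by decide)
  have y2 := hF ![1, 1, 0] (by decide)
  have z := hF ![1, 1, 1] (by decide)
  -- The first group has weights 100, 011, 111 and is the part to be rotated. After one rotation its
  -- weights are 010, 101, 111, which cancel against 010, 101 and 001 + 110 of the second group;
  -- after two rotations they cancel against 001, 110 and 010 + 101. With `q` this gives four
  -- zero-weight factors.
  rw [hprod, mul_left_comm]
  refine rotSum_mul_add_mem ih (hzero ((x0.mul y0).mul z) (by decide))
    (hq.mul_zero (hzero (((x1.mul x2).mul y1).mul y2) (by decide))) (by omega) (by omega)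
    (by omega) ?_ ?_
  · have h := rotSum_mem_of_four h6 ih hq
      (hzero ((hg ![1, 0, 0] (by decide)).mul x1) (by decide))
      (hzero ((hg ![0, 1, 1] (by decide)).mul y1) (by decide))
      (hzero (((hg ![1, 1, 1] (by decide)).mul x2).mul y2) (by decide))
      he (by omega) (by omega) (by omega) (by omega)
    convert h using 2
    simp only [map_mul]
    ring
  · have h := rotSum_mem_of_four h6 ih hq
      (hzero ((hgg ![1, 0, 0] (by decide)).mul x2) (by decide))
      (hzero ((hgg ![0, 1, 1] (by decide)).mul y2) (by decide))
      (hzero (((hgg ![1, 1, 1] (by decide)).mul x1).mul y1) (by decide))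
      he (by omega) (by omega) (by omega) (by omega)
    convert h using 2
    simp only [map_mul]
    ring

-- Nine is enough for four factors: two zero-sum pieces of size at most 2 leave at least 5 terms,
-- from which a piece of size at most 4 splits off with a nonempty remainder. The second short piece
-- is missing only if the remainder after the first is a bijective copy of the seven nonzero
-- weights.
include h6 ih in
theorem rotSum_mem_of_nine_le (hd : 9 ≤ d) {p : MvPolynomial (Fin n) K}
    (hp : IsFormProduct w ρ d 0 p) : rotSum w ρ p ∈ B := by
  classical
  obtain ⟨c, f, hf, hc, rfl⟩ := hp.exists_fin
  have hP {s : Finset (Fin d)} (hs : ∑ i ∈ s, c i = 0) :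
      IsFormProduct w ρ s.card 0 (∏ i ∈ s, f i) :=
    hs ▸ IsFormProduct.prod fun i _ => hf i
  obtain ⟨t, -, ht0, htc, hts⟩ := exists_zeroSum_of_eight_le_card c Finset.univ
    (by rw [Finset.card_univ, Fintype.card_fin]; omega)
  have hr := sum_sdiff_eq_zero (Finset.subset_univ t) hc hts
  have hrc := Finset.card_sdiff_add_card_eq_card (Finset.subset_univ t)
  rw [Finset.card_univ, Fintype.card_fin] at hrc
  set r := Finset.univ \ t with hr_def
  have hprod : ∏ i, f i = (∏ i ∈ t, f i) * ∏ i ∈ r, f i := by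
    rw [mul_comm, Finset.prod_sdiff (Finset.subset_univ t)]
  rw [hprod]
  have htpos := ht0.card_pos
  rcases exists_zeroSum_or_bijOn c r (by omega) with ⟨u, hur, hu0, huc, hus⟩ | hbij
  · have hu' := sum_sdiff_eq_zero hur hr hus
    have huc' := Finset.card_sdiff_add_card_eq_card hur
    obtain ⟨a, har, ha0, hac, has⟩ := exists_zeroSum_of_four_le_card c (r \ u) (by omega)
    have ha' := sum_sdiff_eq_zero har hu' has
    have hac' := Finset.card_sdiff_add_card_eq_card har
    have h := rotSum_mem_of_four h6 ih (hP hts) (hP hus) (hP has) (hP ha') htpos hu0.card_pos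
      ha0.card_pos (by omega) (by omega)
    convert h using 2
    rw [← Finset.prod_sdiff hur, ← Finset.prod_sdiff har]
    ring
  · have hrcard : r.card = 7 := by
      have h1 := Finset.card_image_of_injOn hbij.injOn
      have h2 : r.image c = Finset.univ.erase 0 := by
        apply Finset.coe_injective
        rw [Finset.coe_image, hbij.image_eq]
      rw [h2] at h1
      rw [← h1]
      decide
    have : Nonempty (Fin d) := ⟨⟨0, by omega⟩⟩
    have hinv := hbij.invOn_invFunOn
    let F (χ : Fin 3 → ZMod 2) := f (Function.invFunOn c r χ)
    have hFmem (χ) (hχ : χ ≠ 0) : F χ ∈ weightLE w ρ 1 χ := by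
      have h := hf (Function.invFunOn c r χ)
      rwa [hinv.2 (by simpa using hχ)] at h
    have h := rotSum_mem_of_all_weights h6 ih hFmem (hP hts) htpos (by omega)
    convert h using 3
    refine Finset.prod_bij (fun i _ => c i) (fun i hi => hbij.mapsTo hi)
      (fun i hi j hj h => hbij.injOn hi hj h) (fun χ hχ => ?_) fun i hi => ?_
    · obtain ⟨i, hi, h⟩ := hbij.surjOn hχ
      exact ⟨i, hi, h⟩
    · simp only [F]
      rw [hinv.1 hi]

end Decomposition

theorem rotSum_mem_adjoin (h6 : (6 : K) ≠ 0) (d : ℕ) (p : MvPolynomial (Fin n) K)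
    (hp : IsFormProduct w ρ d 0 p) :
    rotSum w ρ p ∈ Algebra.adjoin K (invariantsLE ρ 8) := by
  induction d using Nat.strong_induction_on generalizing p with
  | _ d ih =>
    rcases le_or_gt d 8 with hd | hd
    · exact Algebra.subset_adjoin (rotSum_mem (weightLE.mono hp.mem_weightLE hd))
    · exact rotSum_mem_of_nine_le h6 ih hd hp

/-- The sum over the group generated by the involutions. -/
def invSum (w : WreathGenerators G) (ρ : G →* GL (Fin n) K) :
    MvPolynomial (Fin n) K →ₗ[K] MvPolynomial (Fin n) K :=
  (LinearMap.id + (polyAction ρ (w.inv 0)).toLinearMap) ∘ₗ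
    (LinearMap.id + (polyAction ρ (w.inv 1)).toLinearMap) ∘ₗ
    (LinearMap.id + (polyAction ρ (w.inv 2)).toLinearMap)

theorem invSum_of_mem {k : ℕ} {χ : Fin 3 → ZMod 2} {f : MvPolynomial (Fin n) K}
    (hf : f ∈ weightLE w ρ k χ) :
    invSum w ρ f = ((1 + sgn K (χ 0)) * (1 + sgn K (χ 1)) * (1 + sgn K (χ 2))) • f := by
  simp only [invSum, LinearMap.comp_apply, LinearMap.add_apply, LinearMap.id_apply,
    AlgHom.toLinearMap_apply, map_add, hf.2, map_smul]
  module

theorem adjoin_invariantsLE_eight (h2 : (2 : K) ≠ 0) (h3 : (3 : K) ≠ 0) (w : WreathGenerators G)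
    (ρ : G →* GL (Fin n) K) : Algebra.adjoin K (invariantsLE ρ 8) = invariants ρ := by
  have h6 : (6 : K) ≠ 0 := by
    rw [show (6 : K) = 2 * 3 by norm_num]
    exact mul_ne_zero h2 h3
  refine le_antisymm (Algebra.adjoin_le fun f hf => hf.1) fun f hf => ?_
  -- The full transfer `rotSum ∘ invSum` kills products of nonzero weight and sends the others into
  -- the subalgebra; on an invariant it is multiplication by 24.
  have key : Submodule.span K {p | ∃ d χ, IsFormProduct w ρ d χ p} ≤
      (Subalgebra.toSubmodule (Algebra.adjoin K (invariantsLE ρ 8))).comap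
        (rotSum w ρ ∘ₗ invSum w ρ) := by
    rw [Submodule.span_le]
    rintro p ⟨d, χ, hp⟩
    change rotSum w ρ (invSum w ρ p) ∈ Algebra.adjoin K (invariantsLE ρ 8)
    rw [invSum_of_mem hp.mem_weightLE, map_smul]
    by_cases hχ : χ = 0
    · subst hχ
      exact Subalgebra.smul_mem _ (rotSum_mem_adjoin h6 d p hp) _
    · have : (1 + sgn K (χ 0)) * (1 + sgn K (χ 1)) * (1 + sgn K (χ 2)) = 0 := by
        obtain ⟨i, hi⟩ := Function.ne_iff.1 hχ
        have hi' : sgn K (χ i) = -1 := by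
          rcases zmod_two_cases (χ i) with h | h
          · exact absurd h hi
          · rw [h, sgn_one]
        fin_cases i <;> simp at hi' <;> simp [hi']
      rw [this, zero_smul]
      exact zero_mem _
  have h := key (mem_span_isFormProduct h2 f)
  change rotSum w ρ (invSum w ρ f) ∈ Algebra.adjoin K (invariantsLE ρ 8) at h
  have hf' : invSum w ρ f = (8 : K) • f := by
    simp only [invSum, LinearMap.comp_apply, LinearMap.add_apply, LinearMap.id_apply,
      AlgHom.toLinearMap_apply, map_add, hf _]
    module
  have hr : rotSum w ρ f = (3 : K) • f := by
    rw [rotSum_apply, hf, hf]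
    module
  rw [hf', map_smul, hr, smul_smul] at h
  have h24 : (8 * 3 : K) ≠ 0 := by
    rw [show (8 * 3 : K) = 2 * 2 * 6 by norm_num]
    exact mul_ne_zero (mul_ne_zero h2 h2) h6
  have h' := Subalgebra.smul_mem _ h (8 * 3 : K)⁻¹
  rwa [smul_smul, inv_mul_cancel₀ h24, one_smul] at h'

end FormProduct

/-! ### Points that agree on invariants of degree at most 6. -/

section Separation

variable {K : Type*} [Field K] {G : Type*} [Group G] {n : ℕ}
  {w : WreathGenerators G} {ρ : G →* GL (Fin n) K}

theorem rot_eigenvector {ω : K} (hω : ω * ω + ω + 1 = 0) (f : MvPolynomial (Fin n) K) :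
    polyAction ρ w.rot (f + (ω * ω) • polyAction ρ w.rot f +
        ω • polyAction ρ w.rot (polyAction ρ w.rot f)) =
      ω • (f + (ω * ω) • polyAction ρ w.rot f +
        ω • polyAction ρ w.rot (polyAction ρ w.rot f)) := by
  have h3 : ω * (ω * ω) = 1 := by linear_combination (ω - 1) * hω
  simp only [map_add, map_smul, rot_rot_rot, smul_add, smul_smul, h3, one_smul]
  abel

theorem rot_rotSum (f : MvPolynomial (Fin n) K) :
    polyAction ρ w.rot (rotSum w ρ f) = rotSum w ρ f := by
  simp only [rotSum_apply, map_add, rot_rot_rot]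
  abel

/-- The decomposition of a polynomial into eigenvectors of the element of order `3`. -/
theorem exists_eigenvectors (h3 : (3 : K) ≠ 0) {ω : K} (hω : ω * ω + ω + 1 = 0)
    {M : Submodule K (MvPolynomial (Fin n) K)} (hM : ∀ f ∈ M, polyAction ρ w.rot f ∈ M)
    {f : MvPolynomial (Fin n) K} (hf : f ∈ M) :
    ∃ f₀ ∈ M, ∃ f₁ ∈ M, ∃ f₂ ∈ M, f = f₀ + f₁ + f₂ ∧ polyAction ρ w.rot f₀ = f₀ ∧
      polyAction ρ w.rot f₁ = ω • f₁ ∧ polyAction ρ w.rot f₂ = (ω * ω) • f₂ := by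
  have hω' : (ω * ω) * (ω * ω) + ω * ω + 1 = 0 := by
    linear_combination (ω * ω - ω + 1) * hω
  have hr := hM f hf
  have hrr := hM _ hr
  refine ⟨(3 : K)⁻¹ • rotSum w ρ f, ?_, (3 : K)⁻¹ • (f + (ω * ω) • polyAction ρ w.rot f +
        ω • polyAction ρ w.rot (polyAction ρ w.rot f)), ?_, (3 : K)⁻¹ • (f +
        ((ω * ω) * (ω * ω)) • polyAction ρ w.rot f +
        (ω * ω) • polyAction ρ w.rot (polyAction ρ w.rot f)), ?_, ?_, ?_, ?_, ?_⟩
  · rw [rotSum_apply]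
    exact M.smul_mem _ (add_mem (add_mem hf hr) hrr)
  · exact M.smul_mem _ (add_mem (add_mem hf (M.smul_mem _ hr)) (M.smul_mem _ hrr))
  · exact M.smul_mem _ (add_mem (add_mem hf (M.smul_mem _ hr)) (M.smul_mem _ hrr))
  · rw [rotSum_apply, ← smul_add, ← smul_add]
    have hω4 : (ω * ω) * (ω * ω) = ω := by linear_combination (ω * ω - ω) * hω
    have hω2 : ω * ω = -1 - ω := by linear_combination hω
    rw [hω4, eq_inv_smul_iff₀ h3, hω2]
    module
  · rw [map_smul, rot_rotSum]
  · rw [map_smul, rot_eigenvector hω, smul_comm]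
  · rw [map_smul, rot_eigenvector hω', smul_comm]

variable {a b : Fin n → K}

theorem weightLE.rot_mem_zero {k : ℕ} :
    ∀ f ∈ weightLE w ρ k 0, polyAction ρ w.rot f ∈ weightLE w ρ k 0 :=
  fun _ hf => weightLE.rot_zero hf

theorem weightLE.mul_zero {k l : ℕ} {f h : MvPolynomial (Fin n) K}
    (hf : f ∈ weightLE w ρ k 0) (hh : h ∈ weightLE w ρ l 0) : f * h ∈ weightLE w ρ (k + l) 0 := by
  have := weightLE.mul hf hh
  rwa [add_zero] at this

theorem eq_or_eq_of_cube_eq {ω : K} (hω : ω * ω + ω + 1 = 0) {x y : K}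
    (h : x * x * x = y * y * y) : x = y ∨ x = ω * y ∨ x = ω * (ω * y) := by
  have key : (x - y) * ((x - ω * y) * (x - ω * (ω * y))) = 0 := by
    linear_combination h + (x * y * y * ω - x * x * y + y * y * y * (1 - ω)) * hω
  rcases mul_eq_zero.1 key with h | h
  · exact Or.inl (sub_eq_zero.1 h)
  · rcases mul_eq_zero.1 h with h | h
    · exact Or.inr (Or.inl (sub_eq_zero.1 h))
    · exact Or.inr (Or.inr (sub_eq_zero.1 h))

/-- Split `f` into its `rot`-eigencomponents `f₀, f₁, f₂`. Then `f₀`, `u²f₁` and `uf₂` are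
invariants of degree at most 6, and the nonzero value of `u` cancels. -/
theorem agree_two_of_eigenvector (h3 : (3 : K) ≠ 0) {ω : K} (hω : ω * ω + ω + 1 = 0)
    (hab : ∀ f ∈ invariantsLE ρ 6, eval a f = eval b f) {u : MvPolynomial (Fin n) K}
    (hu : u ∈ weightLE w ρ 2 0) (hru : polyAction ρ w.rot u = ω • u) (hua : eval a u ≠ 0)
    (hub : eval a u = eval b u) : ∀ f ∈ weightLE w ρ 2 0, eval a f = eval b f := by
  have hω3 : ω * (ω * ω) = 1 := by linear_combination (ω - 1) * hω
  intro f hf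
  obtain ⟨f₀, h₀, f₁, h₁, f₂, h₂, rfl, hr₀, hr₁, hr₂⟩ :=
    exists_eigenvectors (w := w) (ρ := ρ) h3 hω weightLE.rot_mem_zero hf
  have e0 := hab f₀ (mem_invariantsLE (weightLE.mono h₀ (by norm_num)) hr₀)
  have e1 := hab (u * u * f₁) (mem_invariantsLE (w := w)
    (weightLE.mul_zero (weightLE.mul_zero hu hu) h₁) (by
      rw [map_mul, map_mul, hru, hr₁, smul_mul_smul_comm, smul_mul_smul_comm, mul_assoc, hω3,
        one_smul]))
  have e2 := hab (u * f₂) (mem_invariantsLE (w := w)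
    (weightLE.mono (weightLE.mul_zero hu h₂) (by norm_num)) (by
      rw [map_mul, hru, hr₂, smul_mul_smul_comm, hω3, one_smul]))
  simp only [map_mul, ← hub] at e1 e2
  rw [map_add, map_add, map_add, map_add, e0, mul_left_cancel₀ (mul_ne_zero hua hua) e1,
    mul_left_cancel₀ hua e2]

/-- The cube of `u` is an invariant of degree at most 6, so the values of `u` differ by a cube root
of unity, which a power of `rot` absorbs. -/
theorem exists_polyAction_eigenvector {ω : K} (hω : ω * ω + ω + 1 = 0)
    (hab : ∀ f ∈ invariantsLE ρ 6, eval a f = eval b f) {u : MvPolynomial (Fin n) K}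
    (hu : u ∈ weightLE w ρ 2 0) (hru : polyAction ρ w.rot u = ω • u) :
    ∃ g : G, eval a u = eval b (polyAction ρ g u) := by
  have hω3 : ω * (ω * ω) = 1 := by linear_combination (ω - 1) * hω
  have e := hab (u * u * u) (mem_invariantsLE (w := w)
    (weightLE.mul_zero (weightLE.mul_zero hu hu) hu) (by
      rw [map_mul, map_mul, hru, smul_mul_smul_comm, smul_mul_smul_comm, mul_assoc, hω3,
        one_smul]))
  simp only [map_mul] at e
  rcases eq_or_eq_of_cube_eq hω e with h | h | h
  · exact ⟨1, by rw [polyAction_one, h]⟩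
  · exact ⟨w.rot, by rw [hru, smul_eval, h]⟩
  · exact ⟨w.rot * w.rot, by rw [polyAction_mul, hru, map_smul, hru, smul_eval, smul_eval, h]⟩

/-- If all eigenvectors with nontrivial eigenvalue vanish at `a`, then the invariants of the
involutions of degree at most `2` take the same value at `a`, its rotation, and `b`. -/
theorem agree_two_of_forall_eigenvector (h3 : (3 : K) ≠ 0) {ω : K} (hω : ω * ω + ω + 1 = 0)
    (hab : ∀ f ∈ invariantsLE ρ 6, eval a f = eval b f)
    (h : ∀ η : K, η * η + η + 1 = 0 → ∀ u ∈ weightLE w ρ 2 0, polyAction ρ w.rot u = η • u →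
      eval a u = 0) :
    ∀ f ∈ weightLE w ρ 2 0, eval a (polyAction ρ w.rot f) = eval a f ∧ eval b f = eval a f := by
  have hb : ∀ η : K, η * η + η + 1 = 0 → ∀ u ∈ weightLE w ρ 2 0, polyAction ρ w.rot u = η • u →
      eval b u = 0 := by
    intro η hη u hu hru
    have hω3 : η * (η * η) = 1 := by linear_combination (η - 1) * hη
    have e := hab (u * u * u) (mem_invariantsLE (w := w)
      (weightLE.mul_zero (weightLE.mul_zero hu hu) hu) (by
        rw [map_mul, map_mul, hru, smul_mul_smul_comm, smul_mul_smul_comm, mul_assoc, hω3,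
          one_smul]))
    simpa [h η hη u hu hru] using e.symm
  have hω' : (ω * ω) * (ω * ω) + ω * ω + 1 = 0 := by
    linear_combination (ω * ω - ω + 1) * hω
  intro f hf
  obtain ⟨f₀, h₀, f₁, h₁, f₂, h₂, rfl, hr₀, hr₁, hr₂⟩ :=
    exists_eigenvectors (w := w) (ρ := ρ) h3 hω weightLE.rot_mem_zero hf
  have e0 := hab f₀ (mem_invariantsLE (weightLE.mono h₀ (by norm_num)) hr₀)
  simp only [map_add, hr₀, hr₁, hr₂, smul_eval, h ω hω f₁ h₁ hr₁, h _ hω' f₂ h₂ hr₂,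
    hb ω hω f₁ h₁ hr₁, hb _ hω' f₂ h₂ hr₂, e0]
  simp

/-- A product of two forms of equal weight has weight zero. Hence all pairwise products of values
agree at `a` and `b`, which fixes the values up to one common sign per weight. -/
theorem exists_sign_of_agree_two
    (hab : ∀ f ∈ weightLE w ρ 2 0, eval a f = eval b f) :
    ∃ η : (Fin 3 → ZMod 2) → ZMod 2, ∀ χ, ∀ l ∈ weightLE w ρ 1 χ,
      eval b l = sgn K (η χ) * eval a l := by
  have key (χ : Fin 3 → ZMod 2) : ∃ e : ZMod 2, ∀ l ∈ weightLE w ρ 1 χ,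
      eval b l = sgn K e * eval a l := by
    have hmul {l m} (hl : l ∈ weightLE w ρ 1 χ) (hm : m ∈ weightLE w ρ 1 χ) :
        eval a l * eval a m = eval b l * eval b m := by
      have h := weightLE.mul hl hm
      rw [zmod_two_add_self] at h
      simpa using hab _ h
    by_cases h0 : ∃ l ∈ weightLE w ρ 1 χ, eval a l ≠ 0
    · obtain ⟨l, hl, hla⟩ := h0
      have : ∃ e : ZMod 2, eval b l = sgn K e * eval a l := by
        rcases mul_self_eq_mul_self_iff.1 (hmul hl hl).symm with h | h
        · exact ⟨0, by simpa using h⟩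
        · exact ⟨1, by simpa using h⟩
      obtain ⟨e, he⟩ := this
      refine ⟨e, fun m hm => ?_⟩
      have h1 := hmul hl hm
      rw [he] at h1
      refine mul_left_cancel₀ (mul_ne_zero (sgn_ne_zero e) hla) ?_
      rw [← h1]
      linear_combination (-(eval a l * eval a m)) * sgn_mul_self (K := K) e
    · push Not at h0
      refine ⟨0, fun l hl => ?_⟩
      have h := hmul hl hl
      rw [h0 l hl, mul_zero] at h
      rw [h0 l hl, mul_zero]
      exact mul_self_eq_zero.1 h.symm
  choose η hη using key
  exact ⟨η, hη⟩

/-- The weights having a form that does not vanish at `a`. -/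
def InSupport (w : WreathGenerators G) (ρ : G →* GL (Fin n) K) (a : Fin n → K)
    (χ : Fin 3 → ZMod 2) : Prop :=
  ∃ l ∈ weightLE w ρ 1 χ, eval a l ≠ 0

/-- Two points whose weight components agree up to a sign from a linear character of the group
of weights lie in the same orbit. -/
theorem exists_mulVec_eq (h2 : (2 : K) ≠ 0) (ε : Fin 3 → ZMod 2)
    (h : ∀ χ, ∀ l ∈ weightLE w ρ 1 χ,
      eval b l = sgn K (ε 0 * χ 0 + ε 1 * χ 1 + ε 2 * χ 2) * eval a l) :
    ∃ g : G, b = (ρ g : Matrix (Fin n) (Fin n) K) *ᵥ a := by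
  let t (i : Fin 3) : G := if ε i = 0 then 1 else w.inv i
  have ht (i : Fin 3) (χ l) (hl : l ∈ weightLE w ρ 1 χ) :
      polyAction ρ (t i) l = sgn K (ε i * χ i) • l := by
    rcases zmod_two_cases (ε i) with h | h
    · simp [t, h, polyAction_one]
    · simp [t, h, hl.2 i]
  refine ⟨(t 0 * t 1 * t 2)⁻¹, ?_⟩
  have key (f : MvPolynomial (Fin n) K) (hf : f.totalDegree ≤ 1) :
      eval b f = eval a (polyAction ρ (t 0 * t 1 * t 2) f) := by
    have hspan := mem_span_weightLE (w := w) (ρ := ρ) h2 hf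
    clear hf
    induction hspan using Submodule.span_induction with
    | mem l hl =>
      obtain ⟨χ, hl⟩ := Set.mem_iUnion.1 hl
      have e : polyAction ρ (t 0 * t 1 * t 2) l =
          sgn K (ε 0 * χ 0 + ε 1 * χ 1 + ε 2 * χ 2) • l := by
        rw [polyAction_mul, polyAction_mul, ht 2 χ l hl, map_smul, ht 1 χ l hl, map_smul,
          map_smul, ht 0 χ l hl, smul_smul, smul_smul, sgn_add, sgn_add]
        congr 1
        ring
      rw [h χ l hl, e, smul_eval]
    | zero => simp
    | add x y _ _ hx hy => rw [map_add, map_add, map_add, hx, hy]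
    | smul c x _ hx => simp only [map_smul, smul_eval, hx]
  funext j
  have h := key (X j) (totalDegree_X j).le
  rwa [eval_polyAction, eval_X, eval_X] at h

end Separation

/-! ### Avoiding the zeros of two or three linear functionals. -/

section LinearForms

variable {K : Type*} [Field K] {M : Type*} [AddCommGroup M] [Module K M]

theorem exists_ne_zero_of_two {p q : M →ₗ[K] K} (hp : ∃ x, p x ≠ 0) (hq : ∃ x, q x ≠ 0) :
    ∃ x, p x ≠ 0 ∧ q x ≠ 0 := by
  obtain ⟨x, hx⟩ := hp
  obtain ⟨y, hy⟩ := hq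
  by_cases h1 : q x = 0
  · by_cases h2 : p y = 0
    · exact ⟨x + y, by simpa [h2] using hx, by simpa [h1] using hy⟩
    · exact ⟨y, h2, hy⟩
  · exact ⟨x, hx, h1⟩

/-- If `r x = 0`, then `r` is nonzero at every `y + c • x`, while `p` and `q` each vanish for at
most one `c`; the three values 0, 1, -1 of `c` suffice. -/
theorem exists_ne_zero_of_three (h2 : (2 : K) ≠ 0) {p q r : M →ₗ[K] K} (hp : ∃ x, p x ≠ 0)
    (hq : ∃ x, q x ≠ 0) (hr : ∃ x, r x ≠ 0) : ∃ x, p x ≠ 0 ∧ q x ≠ 0 ∧ r x ≠ 0 := by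
  obtain ⟨x, hpx, hqx⟩ := exists_ne_zero_of_two hp hq
  by_cases hrx : r x = 0
  swap
  · exact ⟨x, hpx, hqx, hrx⟩
  obtain ⟨y, hy⟩ := hr
  have key (c : K) : (p (y + c • x) ≠ 0 ∧ q (y + c • x) ≠ 0) → ∃ x, p x ≠ 0 ∧ q x ≠ 0 ∧ r x ≠ 0 :=
    fun h => ⟨y + c • x, h.1, h.2, by simpa [hrx] using hy⟩
  by_contra hcon
  have h' (c : K) : p y + c * p x = 0 ∨ q y + c * q x = 0 := by
    by_contra h
    push Not at h
    exact hcon (key c (by simpa using h))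
  have two {s : M →ₗ[K] K} (hs : s x ≠ 0) {c d : K} (hc : s y + c * s x = 0)
      (hd : s y + d * s x = 0) : c = d :=
    mul_right_cancel₀ hs (by linear_combination hc - hd)
  have h01 : (0 : K) ≠ 1 := zero_ne_one
  have h0n : (0 : K) ≠ -1 := fun h => one_ne_zero (α := K) (by linear_combination h)
  have h1n : (1 : K) ≠ -1 := fun h => h2 (by linear_combination h)
  rcases h' 0 with e0 | e0 <;> rcases h' 1 with e1 | e1 <;> rcases h' (-1) with e2 | e2
  · exact h01 (two hpx e0 e1)
  · exact h01 (two hpx e0 e1)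
  · exact h0n (two hpx e0 e2)
  · exact h1n (two hqx e1 e2)
  · exact h1n (two hpx e1 e2)
  · exact h0n (two hqx e0 e2)
  · exact h01 (two hqx e0 e1)
  · exact h01 (two hqx e0 e1)

end LinearForms

/-! ### Extending signs to linear characters. -/

section Signs

/-- A sign function on a set of weights that is additive on zero-sum subsets with at most four
elements extends to a linear character. -/
theorem exists_linear_extension (S : Set (Fin 3 → ZMod 2)) (η : (Fin 3 → ZMod 2) → ZMod 2)
    (h : ∀ T : Finset (Fin 3 → ZMod 2), (∀ χ ∈ T, χ ∈ S) → T.card ≤ 4 → ∑ χ ∈ T, χ = 0 →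
      ∑ χ ∈ T, η χ = 0) :
    ∃ ε : Fin 3 → ZMod 2, ∀ χ ∈ S, η χ = ε 0 * χ 0 + ε 1 * χ 1 + ε 2 * χ 2 := by
  classical
  -- Larger zero-sum sets are cut down by repeatedly removing zero-sum pieces of at most four
  -- elements.
  have h' (k : ℕ) : ∀ T : Finset (Fin 3 → ZMod 2), T.card = k → (∀ χ ∈ T, χ ∈ S) →
      ∑ χ ∈ T, χ = 0 → ∑ χ ∈ T, η χ = 0 := by
    induction k using Nat.strong_induction_on with
    | _ k ih =>
      intro T hT hTS hsum
      rcases le_or_gt T.card 4 with h4 | h4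
      · exact h T hTS h4 hsum
      · obtain ⟨t, htT, ht0, ht4, hts⟩ := exists_zeroSum_of_four_le_card id T h4.le
        have hc := Finset.card_sdiff_add_card_eq_card htT
        have htpos := ht0.card_pos
        rw [← Finset.sum_sdiff htT, h t (fun χ hχ => hTS χ (htT hχ)) ht4 hts,
          ih _ (by omega) (T \ t) rfl (fun χ hχ => hTS χ (Finset.sdiff_subset hχ))
            (sum_sdiff_eq_zero (χ := id) htT hsum hts), add_zero]
  let A : Finset (Fin 3 → ZMod 2) := Finset.univ.filter (· ∈ S)
  -- `f` records linear relations among the weights in `S` and `φ` the matching sums of signs. Since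
  -- `φ` vanishes on the kernel of `f`, it factors through `f`, and the factor `ψ` is the required
  -- character.
  let f : ((Fin 3 → ZMod 2) → ZMod 2) →ₗ[ZMod 2] (Fin 3 → ZMod 2) :=
    ∑ χ ∈ A, (LinearMap.proj χ).smulRight χ
  let φ : ((Fin 3 → ZMod 2) → ZMod 2) →ₗ[ZMod 2] ZMod 2 :=
    ∑ χ ∈ A, (LinearMap.proj χ).smulRight (η χ)
  have hf (c) : f c = ∑ χ ∈ A, c χ • χ := by simp [f]
  have hφ (c) : φ c = ∑ χ ∈ A, c χ • η χ := by simp [φ]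
  have hker : φ ∈ f.ker.dualAnnihilator := by
    rw [Submodule.mem_dualAnnihilator]
    intro c hc
    rw [LinearMap.mem_ker, hf] at hc
    have hite {M : Type} [AddCommGroup M] [Module (ZMod 2) M] (g : (Fin 3 → ZMod 2) → M) :
        ∑ χ ∈ A, c χ • g χ = ∑ χ ∈ A.filter (c · = 1), g χ := by
      rw [Finset.sum_filter (s := A) (p := (c · = 1))]
      refine Finset.sum_congr rfl fun χ _ => ?_
      rcases zmod_two_cases (c χ) with h | h <;> simp [h]
    rw [hφ, hite]
    refine h' _ _ rfl (fun χ hχ => ?_) ?_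
    · simpa [A] using (Finset.mem_filter.1 (Finset.mem_filter.1 hχ).1).2
    · rw [← hite, hc]
  rw [← LinearMap.range_dualMap_eq_dualAnnihilator_ker] at hker
  obtain ⟨ψ, hψ⟩ := hker
  refine ⟨fun i => ψ (Pi.single i 1), fun χ hχ => ?_⟩
  have hA : χ ∈ A := by simpa [A] using hχ
  have e := LinearMap.congr_fun hψ (Pi.single χ 1)
  rw [LinearMap.dualMap_apply, hf, hφ] at e
  have hsingle {M : Type} [AddCommGroup M] [Module (ZMod 2) M] (g : (Fin 3 → ZMod 2) → M) :
      ∑ ξ ∈ A, (Pi.single χ 1 : (Fin 3 → ZMod 2) → ZMod 2) ξ • g ξ = g χ := by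
    rw [Finset.sum_eq_single_of_mem χ hA]
    · simp
    · intro ξ _ hξ
      simp [hξ]
  rw [hsingle, hsingle] at e
  rw [← e]
  conv_lhs => rw [pi_eq_sum_univ' χ]
  rw [map_sum, Fin.sum_univ_three]
  simp only [map_smul, smul_eq_mul, mul_comm]

/-- Triples with the same absolute values and the same sum agree up to a cyclic shift. -/
theorem cyclic_shift_of_sum_eq {K : Type*} [Field K] (h2 : (2 : K) ≠ 0) (h3 : (3 : K) ≠ 0) {c : K}
    (hc : c ≠ 0) {p₀ p₁ p₂ q₀ q₁ q₂ : K} (hp₀ : p₀ = c ∨ p₀ = -c) (hp₁ : p₁ = c ∨ p₁ = -c)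
    (hp₂ : p₂ = c ∨ p₂ = -c) (hq₀ : q₀ = c ∨ q₀ = -c) (hq₁ : q₁ = c ∨ q₁ = -c)
    (hq₂ : q₂ = c ∨ q₂ = -c) (h : p₀ + p₁ + p₂ = q₀ + q₁ + q₂) :
    (q₀ = p₀ ∧ q₁ = p₁ ∧ q₂ = p₂) ∨ (q₀ = p₁ ∧ q₁ = p₂ ∧ q₂ = p₀) ∨
      (q₀ = p₂ ∧ q₁ = p₀ ∧ q₂ = p₁) := by
  -- Different numbers of minus signs would make the sums differ by ±2c, ±4c or ±6c. With equal
  -- numbers, two sign triples are cyclic shifts of each other.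
  have hc2 : 2 * c ≠ 0 := mul_ne_zero h2 hc
  have hc4 : 2 * (2 * c) ≠ 0 := mul_ne_zero h2 hc2
  have hc6 : 3 * (2 * c) ≠ 0 := mul_ne_zero h3 hc2
  rcases hp₀ with rfl | rfl <;> rcases hp₁ with rfl | rfl <;> rcases hp₂ with rfl | rfl <;>
    rcases hq₀ with rfl | rfl <;> rcases hq₁ with rfl | rfl <;> rcases hq₂ with rfl | rfl <;>
    first
    | exact Or.inl ⟨rfl, rfl, rfl⟩
    | exact Or.inr (Or.inl ⟨rfl, rfl, rfl⟩)
    | exact Or.inr (Or.inr ⟨rfl, rfl, rfl⟩)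
    | exact absurd (by linear_combination h) hc2
    | exact absurd (by linear_combination -h) hc2
    | exact absurd (by linear_combination h) hc4
    | exact absurd (by linear_combination -h) hc4
    | exact absurd (by linear_combination h) hc6
    | exact absurd (by linear_combination -h) hc6

end Signs

/-! ### Sign relations along the shift orbits of weights. -/

section Orbits

variable {K : Type*} [Field K] {G : Type*} [Group G] {n : ℕ}
  {w : WreathGenerators G} {ρ : G →* GL (Fin n) K} {a b : Fin n → K}

/-- The sum of a weight over its orbit under the cyclic shift. -/
theorem add_shift_add_shift (χ : Fin 3 → ZMod 2) :
    χ + shift χ + shift (shift χ) = fun _ => χ 0 + χ 1 + χ 2 := by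
  revert χ; decide

/-- Rotating forms of the shifted weights back to `χ` shows that evaluation at `a`, precomposed with
each power of `rot`, is a nonzero functional on forms of weight `χ`; one form then serves all three.
-/
theorem exists_forall_rot_ne_zero (h2 : (2 : K) ≠ 0) {χ : Fin 3 → ZMod 2}
    (h0 : InSupport w ρ a χ) (h1 : InSupport w ρ a (shift χ))
    (h2' : InSupport w ρ a (shift (shift χ))) :
    ∃ l ∈ weightLE w ρ 1 χ, eval a l ≠ 0 ∧ eval a (polyAction ρ w.rot l) ≠ 0 ∧
      eval a (polyAction ρ w.rot (polyAction ρ w.rot l)) ≠ 0 := by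
  let ev : MvPolynomial (Fin n) K →ₗ[K] K := (aeval a).toLinearMap
  have hev (f) : ev f = eval a f := by simp [ev]
  let r := (polyAction ρ w.rot).toLinearMap
  obtain ⟨l₀, hl₀, e₀⟩ := h0
  obtain ⟨l₁, hl₁, e₁⟩ := h1
  obtain ⟨l₂, hl₂, e₂⟩ := h2'
  have m₁ := weightLE.rot (weightLE.rot hl₁)
  rw [shift_shift_shift] at m₁
  have m₂ := weightLE.rot hl₂
  rw [shift_shift_shift] at m₂
  obtain ⟨⟨l, hl⟩, h⟩ := exists_ne_zero_of_three h2 (p := ev ∘ₗ (weightLE w ρ 1 χ).subtype)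
    (q := (ev ∘ₗ r) ∘ₗ (weightLE w ρ 1 χ).subtype)
    (r := (ev ∘ₗ r ∘ₗ r) ∘ₗ (weightLE w ρ 1 χ).subtype)
    ⟨⟨l₀, hl₀⟩, by simpa [hev] using e₀⟩ ⟨⟨_, m₁⟩, by simpa [hev, r, rot_rot_rot] using e₁⟩
    ⟨⟨_, m₂⟩, by simpa [hev, r, rot_rot_rot] using e₂⟩
  exact ⟨l, hl, by simpa [hev, r] using h⟩

theorem odd_weight_cases (χ ψ : Fin 3 → ZMod 2) (hχ : χ 0 + χ 1 + χ 2 = 1)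
    (hψ : ψ 0 + ψ 1 + ψ 2 = 1) :
    χ = 1 ∨ ψ = 1 ∨ ψ = χ ∨ ψ = shift χ ∨ ψ = shift (shift χ) := by
  have cases : ∀ χ : Fin 3 → ZMod 2, χ 0 + χ 1 + χ 2 = 1 →
      χ = 1 ∨ χ = ![1, 0, 0] ∨ χ = ![0, 1, 0] ∨ χ = ![0, 0, 1] := by decide
  rcases cases χ hχ with rfl | rfl | rfl | rfl <;>
    rcases cases ψ hψ with rfl | rfl | rfl | rfl <;> decide

variable {η : (Fin 3 → ZMod 2) → ZMod 2}
  (hη : ∀ χ, ∀ l ∈ weightLE w ρ 1 χ, eval b l = sgn K (η χ) * eval a l)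

include hη in
theorem eval_prod_eq {T : Finset (Fin 3 → ZMod 2)} {c : (Fin 3 → ZMod 2) → (Fin 3 → ZMod 2)}
    {l : (Fin 3 → ZMod 2) → MvPolynomial (Fin n) K} (hl : ∀ χ ∈ T, l χ ∈ weightLE w ρ 1 (c χ)) :
    eval b (∏ χ ∈ T, l χ) = sgn K (∑ χ ∈ T, η (c χ)) * eval a (∏ χ ∈ T, l χ) := by
  rw [map_prod, map_prod, sgn_sum, ← Finset.prod_mul_distrib]
  exact Finset.prod_congr rfl fun χ hχ => hη _ _ (hl χ hχ)

theorem eq_zero_of_eq_sgn_mul (h2 : (2 : K) ≠ 0) {e : ZMod 2} {x : K} (hx : x ≠ 0)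
    (h : x = sgn K e * x) : e = 0 := by
  refine sgn_injective h2 ?_
  rw [sgn_zero]
  exact mul_right_cancel₀ hx (by rw [← h, one_mul])

variable (hab : ∀ f ∈ invariantsLE ρ 6, eval a f = eval b f)

/-- The product of a polynomial with its rotations. -/
def rotProd (w : WreathGenerators G) (ρ : G →* GL (Fin n) K) (f : MvPolynomial (Fin n) K) :
    MvPolynomial (Fin n) K :=
  f * polyAction ρ w.rot f * polyAction ρ w.rot (polyAction ρ w.rot f)

theorem rot_rotProd (f : MvPolynomial (Fin n) K) :
    polyAction ρ w.rot (rotProd w ρ f) = rotProd w ρ f := by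
  simp only [rotProd, map_mul, rot_rot_rot]
  ring

theorem rotProd_mem {χ : Fin 3 → ZMod 2} {l : MvPolynomial (Fin n) K}
    (hl : l ∈ weightLE w ρ 1 χ) :
    rotProd w ρ l ∈ weightLE w ρ 3 (fun _ => χ 0 + χ 1 + χ 2) := by
  have h := weightLE.mul (weightLE.mul hl (weightLE.rot hl)) (weightLE.rot (weightLE.rot hl))
  rwa [add_shift_add_shift] at h

include hη in
theorem eval_rotProd {χ : Fin 3 → ZMod 2} {l : MvPolynomial (Fin n) K}
    (hl : l ∈ weightLE w ρ 1 χ) :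
    eval b (rotProd w ρ l) =
      sgn K (η χ + η (shift χ) + η (shift (shift χ))) * eval a (rotProd w ρ l) := by
  simp only [rotProd, map_mul, hη _ _ hl, hη _ _ (weightLE.rot hl),
    hη _ _ (weightLE.rot (weightLE.rot hl)), sgn_add]
  ring

-- For even `χ` the product of `l` with its two rotations has weight zero, so it is a cubic
-- invariant and its sign is trivial.
include hη hab in
theorem sign_orbit_of_even (h2 : (2 : K) ≠ 0) {χ : Fin 3 → ZMod 2} (hχ : χ 0 + χ 1 + χ 2 = 0)
    (h0 : InSupport w ρ a χ) (h1 : InSupport w ρ a (shift χ))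
    (h2' : InSupport w ρ a (shift (shift χ))) :
    η χ + η (shift χ) + η (shift (shift χ)) = 0 := by
  obtain ⟨l, hl, e0, e1, e2⟩ := exists_forall_rot_ne_zero h2 h0 h1 h2'
  have hm := rotProd_mem hl
  rw [hχ] at hm
  have h := hab _ (mem_invariantsLE (weightLE.mono hm (by norm_num)) (rot_rotProd l))
  rw [eval_rotProd hη hl] at h
  exact eq_zero_of_eq_sgn_mul h2 (by simpa [rotProd] using ⟨⟨e0, e1⟩, e2⟩) h

theorem weightLE.rot_one {k : ℕ} {f : MvPolynomial (Fin n) K}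
    (hf : f ∈ weightLE w ρ k 1) : polyAction ρ w.rot f ∈ weightLE w ρ k 1 := by
  have h := weightLE.rot (χ := 1) hf
  rwa [show shift 1 = 1 from rfl] at h

-- For odd `χ` the product of the three rotations has weight 111. Multiplying it by `m³`, for a
-- `rot`-eigenvector `m` of weight 111 with `m(a) ≠ 0`, gives an invariant of degree at most 6 whose
-- sign must be trivial.
include hη hab in
theorem sign_orbit_of_odd (h2 : (2 : K) ≠ 0) (h3 : (3 : K) ≠ 0) {ω : K} (hω : ω * ω + ω + 1 = 0)
    {χ : Fin 3 → ZMod 2} (hχ : χ 0 + χ 1 + χ 2 = 1)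
    (h0 : InSupport w ρ a χ) (h1 : InSupport w ρ a (shift χ))
    (h2' : InSupport w ρ a (shift (shift χ))) (hz : InSupport w ρ a 1) :
    η χ + η (shift χ) + η (shift (shift χ)) = η 1 := by
  obtain ⟨l, hl, e0, e1, e2⟩ := exists_forall_rot_ne_zero h2 h0 h1 h2'
  obtain ⟨m, μ, hm, hma, hrm, hμ⟩ : ∃ (m : MvPolynomial (Fin n) K) (μ : K),
      m ∈ weightLE w ρ 1 1 ∧ eval a m ≠ 0 ∧ polyAction ρ w.rot m = μ • m ∧ μ * μ * μ = 1 := by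
    obtain ⟨m, hm, hma⟩ := hz
    obtain ⟨f₀, h₀, f₁, h₁, f₂, h₂, rfl, hr₀, hr₁, hr₂⟩ :=
      exists_eigenvectors (w := w) (ρ := ρ) h3 hω (M := weightLE w ρ 1 1)
        (fun f hf => weightLE.rot_one hf) hm
    have hω3 : ω * ω * ω = 1 := by linear_combination (ω - 1) * hω
    by_cases c0 : eval a f₀ = 0
    · by_cases c1 : eval a f₁ = 0
      · refine ⟨f₂, ω * ω, h₂, fun c2 => hma ?_, hr₂, ?_⟩
        · rw [map_add, map_add, c0, c1, c2]; simp
        · linear_combination (ω * ω * ω + 1) * hω3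
      · exact ⟨f₁, ω, h₁, c1, hr₁, hω3⟩
    · exact ⟨f₀, 1, h₀, c0, by rw [hr₀, one_smul], by norm_num⟩
  have hmem := weightLE.mul (weightLE.mul (weightLE.mul (rotProd_mem hl) hm) hm) hm
  rw [hχ, show ((fun _ => 1 : Fin 3 → ZMod 2) + 1 + 1 + 1) = 0 by decide] at hmem
  have h := hab _ (mem_invariantsLE hmem (by
    simp only [map_mul, rot_rotProd, hrm, smul_mul_assoc, mul_smul_comm, smul_smul, ← mul_assoc,
      hμ, one_smul]))
  have hs : eval b (rotProd w ρ l * m * m * m) =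
      sgn K (η χ + η (shift χ) + η (shift (shift χ)) + η 1) *
        eval a (rotProd w ρ l * m * m * m) := by
    simp only [map_mul, eval_rotProd hη hl, hη _ _ hm, sgn_add _ (η 1)]
    linear_combination (sgn K (η χ + η (shift χ) + η (shift (shift χ))) * sgn K (η 1) *
      eval a (rotProd w ρ l) * eval a m * eval a m * eval a m) * sgn_mul_self (K := K) (η 1)
  rw [hs] at h
  have h0 := eq_zero_of_eq_sgn_mul h2
    (by simpa [rotProd, hma] using ⟨⟨e0, e1⟩, e2⟩) h
  exact CharTwo.add_eq_zero.1 h0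

-- A bad sign on the product `f` over `T` would force the same bad sign on both rotations of `f`, by
-- comparing the transfers of `f` and `u * f`. All shifts of `T` then lie in the support, and the
-- orbit relations contradict the three bad signs.
include hη hab in
theorem sign_sum_eq_zero_of_eigenvector (h2 : (2 : K) ≠ 0) (h3 : (3 : K) ≠ 0) {ω : K}
    (hω : ω * ω + ω + 1 = 0) {u : MvPolynomial (Fin n) K}
    (hu : u ∈ weightLE w ρ 2 0) (hru : polyAction ρ w.rot u = ω • u) (hua : eval a u ≠ 0)
    (hub : eval a u = eval b u) {T : Finset (Fin 3 → ZMod 2)}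
    (hT : ∀ χ ∈ T, InSupport w ρ a χ) (hT4 : T.card ≤ 4) (hsum : ∑ χ ∈ T, χ = 0) :
    ∑ χ ∈ T, η χ = 0 := by
  by_contra hbad
  replace hbad := (zmod_two_cases _).resolve_left hbad
  choose! l hl hla using hT
  have hl1 (χ) (hχ : χ ∈ T) := weightLE.rot (hl χ hχ)
  have hl2 (χ) (hχ : χ ∈ T) := weightLE.rot (hl1 χ hχ)
  set r := polyAction ρ w.rot with hr
  let f := ∏ χ ∈ T, l χ
  have hf : f ∈ weightLE w ρ 4 0 := by
    have h := weightLE.prod hl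
    rw [hsum] at h
    exact weightLE.mono h hT4
  have hfa : eval a f ≠ 0 := by
    simp only [f, map_prod]
    exact Finset.prod_ne_zero_iff.2 hla
  have hrf : r f = ∏ χ ∈ T, r (l χ) := map_prod _ _ _
  have hrrf : r (r f) = ∏ χ ∈ T, r (r (l χ)) := by rw [hrf, map_prod]
  have e0 : eval b f = -eval a f := by
    have h := eval_prod_eq hη hl
    rw [hbad, sgn_one] at h
    simpa [f] using h
  have e1 := eval_prod_eq hη hl1
  have e2 := eval_prod_eq hη hl2
  rw [← hrf] at e1
  rw [← hrrf] at e2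
  have s0 := hab _ (rotSum_mem (weightLE.mono hf (by norm_num)))
  have s1 := hab _ (rotSum_mem (weightLE.mul_zero hu hf))
  simp only [rotSum_apply, map_add, map_mul, hru, ← hr, map_smul, smul_eval, ← hub] at s0 s1
  -- With `D₁`, `D₂` the changes of `r f` and `r (r f)` from `a` to `b`, these are `2f(a) + ωD₁ +
  -- ω²D₂ = 0` and `2f(a) + D₁ + D₂ = 0`. They give `D₂ = ωD₁`, with both nonzero.
  have d1 : 2 * eval a f + ω * (eval a (r f) - eval b (r f)) +
      ω * ω * (eval a (r (r f)) - eval b (r (r f))) = 0 := by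
    refine (mul_eq_zero.1 ?_).resolve_left hua
    linear_combination s1 + eval a u * e0
  have d0 : 2 * eval a f + (eval a (r f) - eval b (r f)) +
      (eval a (r (r f)) - eval b (r (r f))) = 0 := by
    linear_combination s0 + e0
  have hω1 : ω - 1 ≠ 0 := fun h => h3 (by linear_combination hω - (ω + 2) * h)
  have d12 : eval a (r (r f)) - eval b (r (r f)) = ω * (eval a (r f) - eval b (r f)) := by
    refine mul_left_cancel₀ hω1 ?_
    linear_combination (-ω) * (d1 - d0) +
      (ω - 1) * (eval a (r (r f)) - eval b (r (r f))) * hω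
  have n1 : eval a (r f) - eval b (r f) ≠ 0 := fun h =>
    mul_ne_zero h2 hfa (by linear_combination d0 - d12 - (1 + ω) * h)
  have n2 : eval a (r (r f)) - eval b (r (r f)) ≠ 0 := fun h =>
    mul_ne_zero h2 hfa (by
      linear_combination d0 - (1 + ω * ω) * h + ω * ω * d12
        + (eval a (r f) - eval b (r f)) * (ω - 1) * hω)
  have bad {x y : K} {e : ZMod 2} (h : y = sgn K e * x) (hxy : x - y ≠ 0) : e = 1 ∧ x ≠ 0 := by
    constructor
    · refine (zmod_two_cases e).resolve_left fun he => hxy ?_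
      rw [h, he, sgn_zero, one_mul, sub_self]
    · rintro rfl
      exact hxy (by rw [h, mul_zero, sub_zero])
  obtain ⟨b1, c1⟩ := bad e1 n1
  obtain ⟨b2, c2⟩ := bad e2 n2
  rw [hrf, map_prod] at c1
  rw [hrrf, map_prod] at c2
  have S0 (χ) (hχ : χ ∈ T) : InSupport w ρ a χ := ⟨l χ, hl χ hχ, hla χ hχ⟩
  have S1 (χ) (hχ : χ ∈ T) : InSupport w ρ a (shift χ) :=
    ⟨_, hl1 χ hχ, Finset.prod_ne_zero_iff.1 c1 χ hχ⟩
  have S2 (χ) (hχ : χ ∈ T) : InSupport w ρ a (shift (shift χ)) :=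
    ⟨_, hl2 χ hχ, Finset.prod_ne_zero_iff.1 c2 χ hχ⟩
  have even (χ) (hχ : χ ∈ T) (h : χ 0 + χ 1 + χ 2 = 0) :=
    sign_orbit_of_even hη hab h2 h (S0 χ hχ) (S1 χ hχ) (S2 χ hχ)
  have odd (χ) (hχ : χ ∈ T) (h : χ 0 + χ 1 + χ 2 = 1) (hz : (1 : Fin 3 → ZMod 2) ∈ T) :=
    sign_orbit_of_odd hη hab h2 h3 hω h (S0 χ hχ) (S1 χ hχ) (S2 χ hχ) (S0 1 hz)
  have odd_eq (χ) (hχ : χ ∈ T) (ψ) (hψ : ψ ∈ T) (h : χ 0 + χ 1 + χ 2 = 1)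
      (h' : ψ 0 + ψ 1 + ψ 2 = 1) :
      η χ + η (shift χ) + η (shift (shift χ)) = η ψ + η (shift ψ) + η (shift (shift ψ)) := by
    have hT1 : χ = 1 ∨ ψ = 1 → (1 : Fin 3 → ZMod 2) ∈ T := by
      rintro (rfl | rfl) <;> assumption
    rcases odd_weight_cases χ ψ h h' with e | e | rfl | rfl | rfl
    · rw [odd χ hχ h (hT1 (Or.inl e)), odd ψ hψ h' (hT1 (Or.inl e))]
    · rw [odd χ hχ h (hT1 (Or.inr e)), odd ψ hψ h' (hT1 (Or.inr e))]
    · rfl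
    · rw [shift_shift_shift]; ring
    · rw [shift_shift_shift]; ring
  -- Even orbits have trivial sign and all odd weights of `T` share one orbit sign, so the orbit
  -- sign is linear in the parity of the weight.
  obtain ⟨κ, hκ⟩ : ∃ κ : ZMod 2, ∀ χ ∈ T,
      η χ + η (shift χ) + η (shift (shift χ)) = κ * (χ 0 + χ 1 + χ 2) := by
    by_cases h : ∃ χ ∈ T, χ 0 + χ 1 + χ 2 = 1
    · obtain ⟨χ, hχ, h⟩ := h
      refine ⟨η χ + η (shift χ) + η (shift (shift χ)), fun ψ hψ => ?_⟩
      rcases zmod_two_cases (ψ 0 + ψ 1 + ψ 2) with h' | h'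
      · rw [h', mul_zero, even ψ hψ h']
      · rw [h', mul_one, odd_eq ψ hψ χ hχ h' h]
    · refine ⟨0, fun ψ hψ => ?_⟩
      rw [zero_mul, even ψ hψ ((zmod_two_cases _).resolve_right fun h' => h ⟨ψ, hψ, h'⟩)]
  -- Summing over `T` gives 1 + 1 + 1 on the left and, because `T` has sum zero, 0 on the right.
  have total := Finset.sum_congr rfl hκ
  rw [Finset.sum_add_distrib, Finset.sum_add_distrib, hbad, b1, b2, ← Finset.mul_sum,
    Finset.sum_add_distrib, Finset.sum_add_distrib, ← Finset.sum_apply, ← Finset.sum_apply,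
    ← Finset.sum_apply, hsum] at total
  simp at total
  exact absurd total (by decide)

section Fixed

variable (h2 : (2 : K) ≠ 0) (h3 : (3 : K) ≠ 0) {ω : K} (hω : ω * ω + ω + 1 = 0)
  (hrot : ∀ f ∈ weightLE w ρ 2 0, eval a (polyAction ρ w.rot f) = eval a f)

-- The square of a form is a quadratic invariant of the involutions, so its value at `a` survives
-- rotation.
include hrot in
theorem InSupport.shift {χ : Fin 3 → ZMod 2} (h : InSupport w ρ a χ) :
    InSupport w ρ a (shift χ) := by
  obtain ⟨l, hl, hla⟩ := h
  refine ⟨_, weightLE.rot hl, fun h0 => hla ?_⟩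
  have hm := weightLE.mul hl hl
  rw [zmod_two_add_self] at hm
  have e := hrot _ hm
  rw [map_mul, map_mul, h0, mul_zero, map_mul] at e
  exact mul_self_eq_zero.1 e.symm

include h2 h3 hω hη hab hrot in
/-- The case where rotation does not change the invariants of degree at most `2`. -/
theorem exists_linear_of_rot_eq
    (hF : InSupport w ρ a ![1, 0, 0] → InSupport w ρ a ![0, 1, 1] →
      η ![0, 1, 0] + η ![0, 0, 1] = η ![0, 1, 1] ∧ η ![0, 0, 1] + η ![1, 0, 0] = η ![1, 0, 1] ∧
      η ![1, 0, 0] + η ![0, 1, 0] = η ![1, 1, 0]) :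
    ∃ ε : Fin 3 → ZMod 2, ∀ χ, InSupport w ρ a χ → η χ = ε 0 * χ 0 + ε 1 * χ 1 + ε 2 * χ 2 := by
  have two : (2 : ZMod 2) = 0 := rfl
  have x0 : shift ![1, 0, 0] = ![0, 1, 0] := by decide
  have x1 : shift ![0, 1, 0] = ![0, 0, 1] := by decide
  have x2 : shift ![0, 0, 1] = ![1, 0, 0] := by decide
  have y0 : shift ![0, 1, 1] = ![1, 0, 1] := by decide
  have y1 : shift ![1, 0, 1] = ![1, 1, 0] := by decide
  have y2 : shift ![1, 1, 0] = ![0, 1, 1] := by decide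
  have even (χ) (h : χ 0 + χ 1 + χ 2 = 0) (hS : InSupport w ρ a χ) :=
    sign_orbit_of_even hη hab h2 h hS (InSupport.shift hrot hS)
      (InSupport.shift hrot (InSupport.shift hrot hS))
  have odd (χ) (h : χ 0 + χ 1 + χ 2 = 1) (hS : InSupport w ρ a χ) (hz : InSupport w ρ a 1) :=
    sign_orbit_of_odd hη hab h2 h3 hω h hS (InSupport.shift hrot hS)
      (InSupport.shift hrot (InSupport.shift hrot hS)) hz
  have hX1 (h : InSupport w ρ a ![0, 0, 1]) : InSupport w ρ a ![1, 0, 0] :=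
    x2 ▸ InSupport.shift hrot h
  have hX2 (h : InSupport w ρ a ![0, 1, 0]) : InSupport w ρ a ![1, 0, 0] :=
    hX1 (x1 ▸ InSupport.shift hrot h)
  have hY1 (h : InSupport w ρ a ![1, 1, 0]) : InSupport w ρ a ![0, 1, 1] :=
    y2 ▸ InSupport.shift hrot h
  have hY2 (h : InSupport w ρ a ![1, 0, 1]) : InSupport w ρ a ![0, 1, 1] :=
    hY1 (y1 ▸ InSupport.shift hrot h)
  have cases : ∀ χ : Fin 3 → ZMod 2, χ = 0 ∨ χ = ![1, 0, 0] ∨ χ = ![0, 1, 0] ∨ χ = ![0, 0, 1] ∨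
      χ = ![0, 1, 1] ∨ χ = ![1, 0, 1] ∨ χ = ![1, 1, 0] ∨ χ = 1 := by decide
  have zero (h : InSupport w ρ a 0) : η 0 = 0 := by
    have e := even 0 (by decide) h
    rw [shift_zero, shift_zero] at e
    linear_combination e - η 0 * two
  by_cases hx : InSupport w ρ a ![1, 0, 0]
  -- The unit weights lie in the support and dictate `ε`. The even weights then follow from `hF`,
  -- and 111 from the odd orbit relation.
  · refine ⟨![η ![1, 0, 0], η ![0, 1, 0], η ![0, 0, 1]], fun χ hχ => ?_⟩
    rcases cases χ with rfl | rfl | rfl | rfl | rfl | rfl | rfl | rfl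
    · simpa using zero hχ
    · simp
    · simp
    · simp
    · simpa using (hF hx hχ).1.symm
    · simpa [add_comm] using (hF hx (hY2 hχ)).2.1.symm
    · simpa using (hF hx (hY1 hχ)).2.2.symm
    · have e := odd _ (by decide) hx hχ
      rw [x0, x1] at e
      simpa using e.symm
  -- No unit weight is in the support. This `ε` solves the equations for the basis 111, 101, 110;
  -- the value at 011 follows from the even orbit relation.
  · refine ⟨![η 1 + η ![1, 0, 1] + η ![1, 1, 0], η 1 + η ![1, 0, 1], η 1 + η ![1, 1, 0]],
      fun χ hχ => ?_⟩
    have hy (h : InSupport w ρ a ![0, 1, 1]) := even _ (by decide) h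
    rw [y0, y1] at hy
    rcases cases χ with rfl | rfl | rfl | rfl | rfl | rfl | rfl | rfl
    · simpa using zero hχ
    · exact absurd hχ hx
    · exact absurd (hX2 hχ) hx
    · exact absurd (hX1 hχ) hx
    · simp
      linear_combination hy hχ - (η ![1, 0, 1] + η ![1, 1, 0] + η 1) * two
    · simp
      linear_combination -(η ![1, 1, 0] + η 1) * two
    · simp
      linear_combination -(η ![1, 0, 1] + η 1) * two
    · simp
      linear_combination -(η ![1, 1, 0] + η ![1, 0, 1] + η 1) * two

end Fixed

end Orbits

/-! ### The separating bound 6. -/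

section SeparatingDegree

variable {K : Type*} [Field K] {G : Type*} [Group G] {n : ℕ}
  {w : WreathGenerators G} {ρ : G →* GL (Fin n) K} {a b : Fin n → K}

theorem exists_mulVec_eq_of_support (h2 : (2 : K) ≠ 0) {η : (Fin 3 → ZMod 2) → ZMod 2}
    (hη : ∀ χ, ∀ l ∈ weightLE w ρ 1 χ, eval b l = sgn K (η χ) * eval a l)
    (h : ∃ ε : Fin 3 → ZMod 2, ∀ χ, InSupport w ρ a χ → η χ = ε 0 * χ 0 + ε 1 * χ 1 + ε 2 * χ 2) :
    ∃ g : G, b = (ρ g : Matrix (Fin n) (Fin n) K) *ᵥ a := by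
  obtain ⟨ε, hε⟩ := h
  refine exists_mulVec_eq (w := w) h2 ε fun χ l hl => ?_
  rw [hη χ l hl]
  by_cases h0 : eval a l = 0
  · rw [h0, mul_zero, mul_zero]
  · rw [hε χ ⟨l, hl, h0⟩]

/-- The forms asked for in `hF` serve the case of mixed support: agreement at `f` and its rotations,
with nonzero values, says that `η` is additive on each relation of type 010 + 001 = 011. -/
theorem exists_mulVec_eq_of_rot_eq (h2 : (2 : K) ≠ 0) (h3 : (3 : K) ≠ 0) {ω : K}
    (hω : ω * ω + ω + 1 = 0) (hab : ∀ f ∈ invariantsLE ρ 6, eval a f = eval b f)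
    (hrot : ∀ f ∈ weightLE w ρ 2 0, eval a (polyAction ρ w.rot f) = eval a f)
    (hagree : ∀ f ∈ weightLE w ρ 2 0, eval a f = eval b f)
    (hF : InSupport w ρ a ![1, 0, 0] → InSupport w ρ a ![0, 1, 1] →
      ∃ l ∈ weightLE w ρ 1 ![1, 0, 0], ∃ m ∈ weightLE w ρ 1 ![0, 1, 1], ∃ f,
        f = polyAction ρ w.rot l * polyAction ρ w.rot (polyAction ρ w.rot l) * m ∧
        (eval a f ≠ 0 ∧ eval a (polyAction ρ w.rot f) ≠ 0 ∧
          eval a (polyAction ρ w.rot (polyAction ρ w.rot f)) ≠ 0) ∧ eval b f = eval a f ∧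
        eval b (polyAction ρ w.rot f) = eval a (polyAction ρ w.rot f) ∧
        eval b (polyAction ρ w.rot (polyAction ρ w.rot f)) =
          eval a (polyAction ρ w.rot (polyAction ρ w.rot f))) :
    ∃ g : G, b = (ρ g : Matrix (Fin n) (Fin n) K) *ᵥ a := by
  obtain ⟨η, hη⟩ := exists_sign_of_agree_two hagree
  refine exists_mulVec_eq_of_support h2 hη
    (exists_linear_of_rot_eq hη hab h2 h3 hω hrot fun hx hy => ?_)
  obtain ⟨l, hl, m, hm, f, rfl, ⟨n0, n1, n2⟩, q0, q1, q2⟩ := hF hx hy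
  have l1 : polyAction ρ w.rot l ∈ weightLE w ρ 1 ![0, 1, 0] :=
    (show shift ![1, 0, 0] = ![0, 1, 0] by decide) ▸ weightLE.rot hl
  have l2 : polyAction ρ w.rot (polyAction ρ w.rot l) ∈ weightLE w ρ 1 ![0, 0, 1] :=
    (show shift ![0, 1, 0] = ![0, 0, 1] by decide) ▸ weightLE.rot l1
  have m1 : polyAction ρ w.rot m ∈ weightLE w ρ 1 ![1, 0, 1] :=
    (show shift ![0, 1, 1] = ![1, 0, 1] by decide) ▸ weightLE.rot hm
  have m2 : polyAction ρ w.rot (polyAction ρ w.rot m) ∈ weightLE w ρ 1 ![1, 1, 0] :=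
    (show shift ![1, 0, 1] = ![1, 1, 0] by decide) ▸ weightLE.rot m1
  have key {χ ψ ξ} {p q r : MvPolynomial (Fin n) K} (hp : p ∈ weightLE w ρ 1 χ)
      (hq : q ∈ weightLE w ρ 1 ψ) (hr : r ∈ weightLE w ρ 1 ξ) (h0 : eval a (p * q * r) ≠ 0)
      (h : eval b (p * q * r) = eval a (p * q * r)) : η χ + η ψ = η ξ := by
    refine CharTwo.add_eq_zero.1 (eq_zero_of_eq_sgn_mul h2 h0 ?_)
    conv_lhs => rw [← h]
    simp only [map_mul, hη _ _ hp, hη _ _ hq, hη _ _ hr, sgn_add]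
    ring
  simp only [map_mul (polyAction ρ w.rot), rot_rot_rot] at n1 n2 q1 q2
  exact ⟨key l1 l2 hm n0 q0, key l2 hl m1 n1 q1, key hl l1 m2 n2 q2⟩

theorem exists_mulVec_eq_of_agree (h2 : (2 : K) ≠ 0) (h3 : (3 : K) ≠ 0) {ω : K}
    (hω : ω * ω + ω + 1 = 0) (w : WreathGenerators G)
    (hab : ∀ f ∈ invariantsLE ρ 6, eval a f = eval b f) :
    ∃ g : G, b = (ρ g : Matrix (Fin n) (Fin n) K) *ᵥ a := by
  have hinv (g : G) (v : Fin n → K) (f) (hf : f ∈ invariantsLE ρ 6) :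
      eval ((ρ g⁻¹ : Matrix (Fin n) (Fin n) K) *ᵥ v) f = eval v f := by
    rw [← eval_polyAction, hf.1 g]
  by_cases hA : ∃ θ : K, θ * θ + θ + 1 = 0 ∧ ∃ u ∈ weightLE w ρ 2 0,
      polyAction ρ w.rot u = θ • u ∧ eval a u ≠ 0
  · obtain ⟨θ, hθ, u, hu, hru, hua⟩ := hA
    obtain ⟨g, hg⟩ := exists_polyAction_eigenvector hθ hab hu hru
    rw [eval_polyAction] at hg
    set b' := (ρ g⁻¹ : Matrix (Fin n) (Fin n) K) *ᵥ b with hb'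
    have hab' : ∀ f ∈ invariantsLE ρ 6, eval a f = eval b' f := fun f hf => by
      rw [hab f hf, hinv g b f hf]
    obtain ⟨η, hη⟩ := exists_sign_of_agree_two
      (agree_two_of_eigenvector h3 hθ hab' hu hru hua hg)
    obtain ⟨h, hh⟩ := exists_mulVec_eq_of_support h2 hη
      (exists_linear_extension {χ | InSupport w ρ a χ} η fun T hT hT4 hsum =>
        sign_sum_eq_zero_of_eigenvector hη hab' h2 h3 hθ hu hru hua hg hT hT4 hsum)
    refine ⟨g * h, ?_⟩
    rw [map_mul, Units.val_mul, ← Matrix.mulVec_mulVec, ← hh, hb', Matrix.mulVec_mulVec,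
      ← Units.val_mul, ← map_mul, mul_inv_cancel]
    simp
  · have hB : ∀ θ : K, θ * θ + θ + 1 = 0 → ∀ u ∈ weightLE w ρ 2 0,
        polyAction ρ w.rot u = θ • u → eval a u = 0 := by
      intro θ hθ u hu hru
      by_contra h
      exact hA ⟨θ, hθ, u, hu, hru, h⟩
    have hagree := agree_two_of_forall_eigenvector h3 hω hab hB
    by_cases hS : InSupport w ρ a ![1, 0, 0] ∧ InSupport w ρ a ![0, 1, 1]
    swap
    · exact exists_mulVec_eq_of_rot_eq h2 h3 hω hab (fun f hf => (hagree f hf).1)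
        (fun f hf => (hagree f hf).2.symm) fun hx hy => absurd ⟨hx, hy⟩ hS
    obtain ⟨⟨l, hl, hla⟩, m, hm, hma⟩ := hS
    set r := polyAction ρ w.rot with hr
    obtain ⟨f, hf⟩ : ∃ f, f = r l * r (r l) * m := ⟨_, rfl⟩
    have sq {χ} {p : MvPolynomial (Fin n) K} (hp : p ∈ weightLE w ρ 1 χ) :
        p * p ∈ weightLE w ρ 2 0 := by
      have h := weightLE.mul hp hp
      rwa [zmod_two_add_self] at h
    have rsq {χ} {p : MvPolynomial (Fin n) K} (hp : p ∈ weightLE w ρ 1 χ) :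
        eval a (r p) * eval a (r p) = eval a p * eval a p := by
      simpa using (hagree _ (sq hp)).1
    have bsq {χ} {p : MvPolynomial (Fin n) K} (hp : p ∈ weightLE w ρ 1 χ) :
        eval b p * eval b p = eval a p * eval a p := by
      simpa using (hagree _ (sq hp)).2
    have l1 := weightLE.rot hl
    have l2 := weightLE.rot l1
    have m1 := weightLE.rot hm
    have m2 := weightLE.rot m1
    have hfw : f ∈ weightLE w ρ 3 0 := by
      have h := weightLE.mul (weightLE.mul l1 l2) hm
      rw [show shift ![1, 0, 0] + shift (shift ![1, 0, 0]) + ![0, 1, 1] = 0 by decide] at h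
      rw [hf]
      exact h
    have hrf : r f = r (r l) * l * r m := by
      rw [hf, map_mul, map_mul, hr, rot_rot_rot]
    have hrrf : r (r f) = l * r l * r (r m) := by
      rw [hrf, map_mul, map_mul, hr, rot_rot_rot]
    -- Squares of forms are constant under rotation and agree at `b`, so `f` and its rotations take
    -- only the values `±c` at both points. Their sums agree by the cubic transfer, hence the two
    -- triples differ by a cyclic shift.
    let c := eval a l * eval a l * eval a m
    have hc : c ≠ 0 := mul_ne_zero (mul_ne_zero hla hla) hma
    have pm {x : K} (h : x * x = c * c) : x = c ∨ x = -c := mul_self_eq_mul_self_iff.1 h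
    have prod_sq {x y z : K} (hx : x * x = eval a l * eval a l) (hy : y * y = eval a l * eval a l)
        (hz : z * z = eval a m * eval a m) : x * y * z = c ∨ x * y * z = -c := by
      refine pm ?_
      linear_combination y * y * z * z * hx + eval a l * eval a l * z * z * hy +
        eval a l * eval a l * eval a l * eval a l * hz
    have rl := rsq hl
    have rrl := (rsq l1).trans rl
    have rm := rsq hm
    have rrm := (rsq m1).trans rm
    have hp₀ : eval a f = c ∨ eval a f = -c := by
      rw [hf, map_mul, map_mul]; exact prod_sq rl rrl rfl
    have hp₁ : eval a (r f) = c ∨ eval a (r f) = -c := by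
      rw [hrf, map_mul, map_mul]; exact prod_sq rrl rfl rm
    have hp₂ : eval a (r (r f)) = c ∨ eval a (r (r f)) = -c := by
      rw [hrrf, map_mul, map_mul]; exact prod_sq rfl rl rrm
    have hq₀ : eval b f = c ∨ eval b f = -c := by
      rw [hf, map_mul, map_mul]
      exact prod_sq ((bsq l1).trans rl) ((bsq l2).trans rrl) (bsq hm)
    have hq₁ : eval b (r f) = c ∨ eval b (r f) = -c := by
      rw [hrf, map_mul, map_mul]
      exact prod_sq ((bsq l2).trans rrl) (bsq hl) ((bsq m1).trans rm)
    have hq₂ : eval b (r (r f)) = c ∨ eval b (r (r f)) = -c := by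
      rw [hrrf, map_mul, map_mul]
      exact prod_sq (bsq hl) ((bsq l1).trans rl) ((bsq m2).trans rrm)
    have hsum : eval a f + eval a (r f) + eval a (r (r f)) =
        eval b f + eval b (r f) + eval b (r (r f)) := by
      have h := hab _ (rotSum_mem (weightLE.mono hfw (by norm_num)))
      simpa only [rotSum_apply, map_add] using h
    have ne {x : K} (hx : x = c ∨ x = -c) : x ≠ 0 := by
      rcases hx with rfl | rfl
      exacts [hc, neg_ne_zero.2 hc]
    -- Moving `a` by a power of `rot` keeps its quadratic values and undoes the cyclic shift.
    have fin (g : G) (hg : ∀ F ∈ weightLE w ρ 2 0, eval a (polyAction ρ g F) = eval a F)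
        (e₀ : eval b f = eval a (polyAction ρ g f))
        (e₁ : eval b (r f) = eval a (polyAction ρ g (r f)))
        (e₂ : eval b (r (r f)) = eval a (polyAction ρ g (r (r f)))) :
        ∃ g : G, b = (ρ g : Matrix (Fin n) (Fin n) K) *ᵥ a := by
      have n₀ := e₀ ▸ ne hq₀
      have n₁ := e₁ ▸ ne hq₁
      have n₂ := e₂ ▸ ne hq₂
      simp only [eval_polyAction] at e₀ e₁ e₂ n₀ n₁ n₂ hg
      obtain ⟨h, hh⟩ := exists_mulVec_eq_of_rot_eq (w := w) h2 h3 hω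
        (a := (ρ g⁻¹ : Matrix (Fin n) (Fin n) K) *ᵥ a) (b := b)
        (fun F hF => by rw [hinv g a F hF, hab F hF])
        (fun F hF => by rw [hg _ (weightLE.rot_zero hF), hg F hF, (hagree F hF).1])
        (fun F hF => by rw [hg F hF, (hagree F hF).2])
        (fun _ _ => ⟨l, hl, m, hm, f, hf, ⟨n₀, n₁, n₂⟩, e₀, e₁, e₂⟩)
      exact ⟨h * g⁻¹, by rw [hh, map_mul, Units.val_mul, Matrix.mulVec_mulVec]⟩
    rcases cyclic_shift_of_sum_eq h2 h3 hc hp₀ hp₁ hp₂ hq₀ hq₁ hq₂ hsum with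
      ⟨e₀, e₁, e₂⟩ | ⟨e₀, e₁, e₂⟩ | ⟨e₀, e₁, e₂⟩
    · refine fin 1 (fun F _ => by rw [polyAction_one]) ?_ ?_ ?_ <;> rwa [polyAction_one]
    · exact fin w.rot (fun F hF => (hagree F hF).1) e₀ e₁ (by rw [e₂, ← hr, hr, rot_rot_rot])
    · refine fin (w.rot * w.rot) (fun F hF => ?_) ?_ ?_ ?_
      · rw [polyAction_mul, (hagree _ (weightLE.rot_zero hF)).1, (hagree F hF).1]
      · rw [polyAction_mul, e₀]
      · rw [polyAction_mul, e₁, hr, rot_rot_rot]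
      · rw [polyAction_mul, e₂, hr, rot_rot_rot]

theorem isSeparating_invariantsLE_six (h2 : (2 : K) ≠ 0) (h3 : (3 : K) ≠ 0) {ω : K}
    (hω : ω * ω + ω + 1 = 0) (w : WreathGenerators G) (ρ : G →* GL (Fin n) K) :
    IsSeparating ρ (invariantsLE ρ 6) := by
  intro a b hne
  by_contra h
  push Not at h
  obtain ⟨g, rfl⟩ := exists_mulVec_eq_of_agree h2 h3 hω w h
  refine hne (Set.ext fun x => ⟨?_, ?_⟩)
  · rintro ⟨k, rfl⟩
    refine ⟨k * g⁻¹, ?_⟩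
    simp only [map_mul, Units.val_mul, Matrix.mulVec_mulVec, mul_assoc]
    rw [← Units.val_mul, ← map_mul, inv_mul_cancel, map_one, Units.val_one, mul_one]
  · rintro ⟨k, rfl⟩
    exact ⟨k * g, by simp only [map_mul, Units.val_mul, Matrix.mulVec_mulVec]⟩

end SeparatingDegree

/-! ### Lower bounds from a four-dimensional representation. -/

section LowerBound

variable {K : Type*} [Field K] {G : Type*} [Group G]
  {w : WreathGenerators G} {ρ : G →* GL (Fin 4) K} {μ : K}

theorem coeff_aeval_C_mul_X (ε : Fin 4 → K) (f : MvPolynomial (Fin 4) K) (s : Fin 4 →₀ ℕ) :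
    coeff s (aeval (fun j => C (ε j) * X j : Fin 4 → MvPolynomial (Fin 4) K) f) =
      (∏ j, ε j ^ s j) * coeff s f := by
  induction f using MvPolynomial.induction_on' with
  | add p q hp hq => rw [map_add, coeff_add, hp, hq, coeff_add, mul_add]
  | monomial t c =>
    have h : aeval (fun j => C (ε j) * X j : Fin 4 → MvPolynomial (Fin 4) K) (monomial t c) =
        monomial t (c * ∏ j, ε j ^ t j) := by
      rw [aeval_monomial, Finsupp.prod_fintype _ _ (by simp), monomial_eq,
        Finsupp.prod_fintype _ _ (by simp)]
      simp only [mul_pow, Finset.prod_mul_distrib, algebraMap_eq, map_mul, map_prod, map_pow]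
      ring
    rw [h, coeff_monomial, coeff_monomial]
    split_ifs with hst
    · rw [hst, mul_comm]
    · rw [mul_zero]

/-- The restriction of a polynomial to the curve `(t, αt, α²t, t⁸)`. -/
def restrict (α : K) : MvPolynomial (Fin 4) K →ₐ[K] Polynomial K :=
  -- The exponent 8 leaves `x₃` at most linear up to degree 15. For `α = μ²` it also satisfies `α⁸ =
  -- μ`, so rotation acts on the curve as `t ↦ αt`.
  aeval ![Polynomial.X, Polynomial.C α * Polynomial.X, Polynomial.C (α * α) * Polynomial.X,
    Polynomial.X ^ 8]

theorem restrict_X_zero (α : K) : restrict α (X 0) = Polynomial.X := by simp [restrict]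

theorem restrict_X_one (α : K) : restrict α (X 1) = Polynomial.C α * Polynomial.X := by
  simp [restrict]

theorem restrict_X_two (α : K) : restrict α (X 2) = Polynomial.C (α * α) * Polynomial.X := by
  simp [restrict]

theorem restrict_X_three (α : K) : restrict α (X 3) = Polynomial.X ^ 8 := by simp [restrict]

theorem restrict_C (α c : K) : restrict α (C c) = Polynomial.C c := by simp [restrict]

theorem restrict_monomial (α c : K) (s : Fin 4 →₀ ℕ) :
    restrict α (monomial s c) = Polynomial.monomial (s 0 + s 1 + s 2 + 8 * s 3)
      (c * (α ^ s 1 * (α * α) ^ s 2)) := by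
  rw [restrict, aeval_monomial, Finsupp.prod_fintype _ _ (by simp), Fin.prod_univ_four,
    ← Polynomial.C_mul_X_pow_eq_monomial]
  simp only [Matrix.cons_val, mul_pow, map_mul, map_pow, Polynomial.algebraMap_eq]
  ring

theorem exists_coeff_ne_zero_of_restrict {α : K} {f : MvPolynomial (Fin 4) K} {k : ℕ}
    (h : (restrict α f).coeff k ≠ 0) :
    ∃ s ∈ f.support, s 0 + s 1 + s 2 + 8 * s 3 = k := by
  by_contra hcon
  push Not at hcon
  refine h ?_
  conv_lhs => rw [f.as_sum, map_sum, Polynomial.finsetSum_coeff]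
  refine Finset.sum_eq_zero fun s hs => ?_
  rw [restrict_monomial, Polynomial.coeff_monomial, if_neg (hcon s hs)]

/-- Polynomials whose coefficients up to degree `15` are concentrated in degrees divisible
by `6`. -/
def sixDivisible (K : Type*) [Field K] : Subalgebra K (Polynomial K) where
  carrier := {p | ∀ k ≤ 15, p.coeff k ≠ 0 → 6 ∣ k}
  mul_mem' {p q} hp hq k hk h := by
    rw [Polynomial.coeff_mul] at h
    obtain ⟨⟨i, j⟩, hij, hne⟩ := Finset.exists_ne_zero_of_sum_ne_zero h
    rw [Finset.HasAntidiagonal.mem_antidiagonal] at hij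
    simp only at hij hne
    rw [← hij]
    exact dvd_add (hp i (by omega) (left_ne_zero_of_mul hne))
      (hq j (by omega) (right_ne_zero_of_mul hne))
  add_mem' {p q} hp hq k hk h := by
    rw [Polynomial.coeff_add] at h
    by_cases hp0 : p.coeff k = 0
    · exact hq k hk fun h0 => h (by rw [hp0, h0, add_zero])
    · exact hp k hk hp0
  algebraMap_mem' r k _ h := by
    rw [Polynomial.algebraMap_eq, Polynomial.coeff_C] at h
    by_cases hk : k = 0
    · simp [hk]
    · simp [hk] at h

variable
  (hinv : ∀ i j, polyAction ρ (w.inv i) (X j) =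
    (C (if j = i.castSucc ∨ j = 3 then -1 else 1) * X j : MvPolynomial (Fin 4) K))
  (hr0 : polyAction ρ w.rot (X 0) = X 1) (hr1 : polyAction ρ w.rot (X 1) = X 2)
  (hr2 : polyAction ρ w.rot (X 2) = X 0) (hr3 : polyAction ρ w.rot (X 3) = C μ * X 3)
  (hμ : μ * μ + μ + 1 = 0)

include hinv in
theorem even_of_mem_support (h2 : (2 : K) ≠ 0) {f : MvPolynomial (Fin 4) K}
    (hf : f ∈ invariants ρ) {s : Fin 4 →₀ ℕ} (hs : s ∈ f.support) (i : Fin 3) :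
    Even (s i.castSucc + s 3) := by
  have hact : polyAction ρ (w.inv i) =
      aeval (fun j => C (if j = i.castSucc ∨ j = 3 then -1 else 1) * X j) := by
    ext1 j
    rw [hinv, aeval_X]
  have h := coeff_aeval_C_mul_X (fun j => if j = i.castSucc ∨ j = 3 then (-1 : K) else 1) f s
  rw [← hact, hf] at h
  have h1 : (∏ j, (if j = i.castSucc ∨ j = 3 then (-1 : K) else 1) ^ s j) =
      (-1) ^ (s i.castSucc + s 3) := by
    rw [Fin.prod_univ_four]
    fin_cases i <;> simp [pow_add]
  rw [h1] at h
  by_contra hodd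
  rw [Nat.not_even_iff_odd] at hodd
  rw [hodd.neg_one_pow] at h
  exact mul_ne_zero h2 (mem_support_iff.1 hs) (by linear_combination h)

-- Rotation preserves the curve and scales its parameter by `μ²`, of order 3, so only exponents
-- divisible by 3 survive.
include hr0 hr1 hr2 hr3 hμ in
theorem three_dvd_of_restrict_coeff_ne_zero (h3 : (3 : K) ≠ 0) {f : MvPolynomial (Fin 4) K}
    (hf : f ∈ invariants ρ) {k : ℕ} (hk : (restrict (μ * μ) f).coeff k ≠ 0) : 3 ∣ k := by
  have hμ3 : μ * (μ * μ) = 1 := by linear_combination (μ - 1) * hμ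
  have hcomp : (Polynomial.aeval (Polynomial.C (μ * μ) * Polynomial.X)).comp
      (restrict (μ * μ)) = (restrict (μ * μ)).comp (polyAction ρ w.rot) := by
    have h4 : (μ * μ) * ((μ * μ) * (μ * μ)) = 1 := by linear_combination (μ * (μ * μ) + 1) * hμ3
    have h8 : (μ * μ) ^ 8 = μ := by
      linear_combination μ * (μ ^ 12 + μ ^ 9 + μ ^ 6 + μ ^ 3 + 1) * hμ3
    have key (j) : Polynomial.aeval (Polynomial.C (μ * μ) * Polynomial.X)
        (restrict (μ * μ) (X j)) = restrict (μ * μ) (polyAction ρ w.rot (X j)) := by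
      have h4' := congrArg (Polynomial.C (R := K)) h4
      have h8' := congrArg (Polynomial.C (R := K)) h8
      simp only [map_mul, map_one, map_pow] at h4' h8'
      revert j
      simp only [Fin.forall_fin_succ, Fin.succ_zero_eq_one, Fin.succ_one_eq_two, Fin.reduceSucc,
        IsEmpty.forall_iff, and_true, hr0, hr1, hr2, hr3, map_mul, map_pow, restrict_X_zero,
        restrict_X_one, restrict_X_two, restrict_X_three, restrict_C, Polynomial.aeval_X,
        Polynomial.aeval_C, Polynomial.algebraMap_eq, true_and]
      refine ⟨by ring, ?_, ?_⟩
      · linear_combination Polynomial.X * h4'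
      · linear_combination Polynomial.X ^ 8 * h8'
    exact MvPolynomial.algHom_ext key
  have h := DFunLike.congr_fun hcomp f
  simp only [AlgHom.comp_apply] at h
  rw [hf w.rot] at h
  have hc := congrArg (fun p => Polynomial.coeff p k) h
  rw [show Polynomial.aeval (Polynomial.C (μ * μ) * Polynomial.X) (restrict (μ * μ) f) =
    (restrict (μ * μ) f).comp (Polynomial.C (μ * μ) * Polynomial.X) from rfl,
    Polynomial.comp_C_mul_X_coeff] at hc
  have hone : (μ * μ) ^ k = 1 := mul_left_cancel₀ hk (by rw [hc, mul_one])
  have hne : μ * μ ≠ 1 := fun h => h3 (by linear_combination (2 - μ) * hμ + (μ - 1) * h)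
  have hord : orderOf (μ * μ) = 3 :=
    orderOf_eq_prime (by linear_combination (μ * (μ * μ) + 1) * hμ3) hne
  rw [← hord]
  exact orderOf_dvd_of_pow_eq_one hone

include hinv hr0 hr1 hr2 hr3 hμ in
theorem restrict_mem_sixDivisible (h2 : (2 : K) ≠ 0) (h3 : (3 : K) ≠ 0)
    {f : MvPolynomial (Fin 4) K} (hf : f ∈ invariantsLE ρ 7) :
    restrict (μ * μ) f ∈ sixDivisible K := by
  intro k hk hne
  have h3k := three_dvd_of_restrict_coeff_ne_zero hr0 hr1 hr2 hr3 hμ h3 hf.1 hne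
  obtain ⟨s, hs, hsk⟩ := exists_coeff_ne_zero_of_restrict hne
  have e0 : Even (s 0 + s 3) := even_of_mem_support hinv h2 hf.1 hs 0
  have e1 : Even (s 1 + s 3) := even_of_mem_support hinv h2 hf.1 hs 1
  have e2 : Even (s 2 + s 3) := even_of_mem_support hinv h2 hf.1 hs 2
  have hdeg := (le_totalDegree hs).trans hf.2
  rw [Finsupp.sum_fintype _ _ (by simp), Fin.sum_univ_four] at hdeg
  rw [Nat.even_iff] at e0 e1 e2
  -- If `s 3` is even, all exponents are even and so is `k`. If it is odd, `k ≤ 15` forces `s 3 =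
  -- 1`; the other three exponents are odd with sum 3 or 5, so `k` is 11 or 13, not divisible by 3.
  rcases Nat.even_or_odd' (s 3) with ⟨t, ht | ht⟩
  · omega
  · have : t = 0 := by omega
    subst this
    omega

include hinv hr0 hr1 hr2 hr3 hμ in
theorem eight_le_betaRep (h2 : (2 : K) ≠ 0) (h3 : (3 : K) ≠ 0) : 8 ≤ betaRep ρ := by
  have hμ3 : μ * (μ * μ) = 1 := by linear_combination (μ - 1) * hμ
  refine le_iInf₂ fun d hd => ?_
  by_contra hlt
  have hd7 : d ≤ 7 := by
    rw [not_le] at hlt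
    have : d < 8 := by exact_mod_cast hlt
    omega
  -- The quadratic factor is a `rot`-eigenvector, and its square compensates the character of `x₃`.
  -- On the curve its three terms coincide, so `f` restricts to `9t¹⁵`, whose degree is not
  -- divisible by 6.
  let f : MvPolynomial (Fin 4) K := X 0 * X 1 * X 2 * X 3 *
    (X 0 ^ 2 + C (μ * μ) * X 1 ^ 2 + C μ * X 2 ^ 2) ^ 2
  have hCμ : (C μ * (C μ * C μ) : MvPolynomial (Fin 4) K) = 1 := by
    rw [← map_mul, ← map_mul, hμ3, map_one]
  have hf : f ∈ invariants ρ := by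
    refine mem_invariants_of_generators (w := w) (fun i => ?_) ?_
    · simp only [f, map_mul, map_pow, map_add, hinv, algHom_C, algebraMap_eq]
      fin_cases i <;> simp
    · simp only [f, map_mul, map_pow, map_add, hr0, hr1, hr2, hr3, algHom_C, algebraMap_eq]
      linear_combination (X 0 * X 1 * X 2 * X 3 *
        (X 0 ^ 4 + 2 * C μ * X 2 ^ 2 * X 0 ^ 2 + C μ ^ 2 * X 2 ^ 4 - C μ * X 1 ^ 4)) * hCμ
  have hle : Algebra.adjoin K (invariantsLE ρ d) ≤ (sixDivisible K).comap (restrict (μ * μ)) :=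
    Algebra.adjoin_le fun p hp => restrict_mem_sixDivisible hinv hr0 hr1 hr2 hr3 hμ h2 h3
      ⟨hp.1, hp.2.trans hd7⟩
  rw [hd.2] at hle
  have h15 : (restrict (μ * μ) f).coeff 15 ≠ 0 → 6 ∣ 15 := hle hf 15 le_rfl
  have hres : restrict (μ * μ) f = Polynomial.C 9 * Polynomial.X ^ 15 := by
    have hm : (Polynomial.C μ * (Polynomial.C μ * Polynomial.C μ)) = 1 := by
      rw [← map_mul, ← map_mul, hμ3, map_one]
    generalize hC : Polynomial.C μ = m at hm
    simp only [f, map_mul, map_pow, map_add, restrict_X_zero, restrict_X_one, restrict_X_two,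
      restrict_X_three, restrict_C, hC]
    have h6 : m ^ 6 = 1 := by linear_combination (m ^ 3 + 1) * hm
    have h9 : m ^ 9 = 1 := by linear_combination (m ^ 6 + m ^ 3 + 1) * hm
    have e : Polynomial.C (9 : K) = 9 := map_ofNat _ 9
    rw [e]
    linear_combination (Polynomial.X ^ 15 * (1 + m ^ 6 + m ^ 9) ^ 2) * h6 +
      (Polynomial.X ^ 15 * (4 + m ^ 6 + m ^ 9)) * (h6 + h9)
  rw [hres, Polynomial.coeff_C_mul_X_pow, if_pos rfl] at h15
  have h9 : (9 : K) ≠ 0 := by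
    rw [show (9 : K) = 3 * 3 by norm_num]
    exact mul_ne_zero h3 h3
  exact absurd (h15 h9) (by decide)

-- The involutions and `rot` scale the `x₃`-axis by `-1` and `μ`, so invariants restrict there to
-- polynomials in `x₃⁶`. In degree at most 5 they are constant and cannot separate a nonzero axis
-- point from 0.
include hinv hr0 hr1 hr2 hr3 hμ in
theorem six_le_betaSepRep (h2 : (2 : K) ≠ 0) (h3 : (3 : K) ≠ 0) : 6 ≤ betaSepRep ρ := by
  have hμ3 : μ * (μ * μ) = 1 := by linear_combination (μ - 1) * hμ
  refine le_iInf₂ fun d hd => ?_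
  by_contra hlt
  have hd5 : d ≤ 5 := by
    rw [not_le] at hlt
    have : d < 6 := by exact_mod_cast hlt
    omega
  let e : Fin 4 → K := Pi.single 3 1
  have horb : orbit ρ 0 ≠ orbit ρ e := by
    intro h
    have he : e ∈ orbit ρ e := ⟨1, by simp⟩
    rw [← h] at he
    obtain ⟨g, hg⟩ := he
    have := congrFun hg 3
    simp [e] at this
  obtain ⟨f, ⟨hf, hfd⟩, hne⟩ := hd.2 0 e horb
  refine hne ?_
  let φ : MvPolynomial (Fin 4) K →ₐ[K] Polynomial K := aeval (Pi.single 3 Polynomial.X)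
  have hφ (c : K) : eval (Pi.single 3 c) f = Polynomial.eval c (φ f) := by
    have : (aeval (Pi.single 3 c : Fin 4 → K) : MvPolynomial (Fin 4) K →ₐ[K] K) =
        (Polynomial.aeval c).comp φ := by
      ext1 j
      by_cases hj : j = 3
      · subst hj; simp [φ]
      · simp [φ, hj]
    have h := DFunLike.congr_fun this f
    simpa [coe_aeval_eq_eval, Polynomial.coe_aeval_eq_eval] using h
  have hscale (g : G) (c : K) (k : ℕ) (hk : (φ f).coeff k ≠ 0)
      (hg : ∀ j, φ (polyAction ρ g (X j)) = Pi.single (M := fun _ => Polynomial K) 3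
        (Polynomial.C c * Polynomial.X) j) : c ^ k = 1 := by
    have hcomp : (Polynomial.aeval (Polynomial.C c * Polynomial.X)).comp φ =
        φ.comp (polyAction ρ g) := by
      refine MvPolynomial.algHom_ext fun j => ?_
      rw [AlgHom.comp_apply, AlgHom.comp_apply, hg]
      by_cases hj : j = 3
      · subst hj; simp [φ]
      · simp [φ, hj]
    have h := DFunLike.congr_fun hcomp f
    simp only [AlgHom.comp_apply] at h
    rw [hf g] at h
    have hc := congrArg (fun p => Polynomial.coeff p k) h
    rw [show Polynomial.aeval (Polynomial.C c * Polynomial.X) (φ f) =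
      (φ f).comp (Polynomial.C c * Polynomial.X) from rfl,
      Polynomial.comp_C_mul_X_coeff] at hc
    exact mul_left_cancel₀ hk (by rw [hc, mul_one])
  have hcoeff (k : ℕ) (hk : (φ f).coeff k ≠ 0) : 6 ∣ k := by
    have hs1 : (-1 : K) ^ k = 1 := hscale (w.inv 0) (-1) k hk fun j => by
      rw [hinv]
      by_cases hj : j = 3
      · subst hj; simp [φ]
      · simp [φ, hj]
    have hs2 : μ ^ k = 1 := hscale w.rot μ k hk (by
      simp [Fin.forall_fin_succ, hr0, hr1, hr2, hr3, φ])
    have hd2 : 2 ∣ k := by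
      rw [← even_iff_two_dvd]
      by_contra hodd
      rw [Nat.not_even_iff_odd] at hodd
      rw [hodd.neg_one_pow] at hs1
      exact h2 (by linear_combination -hs1)
    have hne : μ ≠ 1 := fun h => h3 (by linear_combination hμ - (μ + 2) * h)
    have hord : orderOf μ = 3 := orderOf_eq_prime (by linear_combination hμ3) hne
    have hd3 : 3 ∣ k := hord ▸ orderOf_dvd_of_pow_eq_one hs2
    omega
  have hdeg : (φ f).natDegree ≤ 5 := by
    have := aeval_natDegree_le (m := 5) (n := 1) f (hfd.trans hd5)
      (Pi.single 3 Polynomial.X : Fin 4 → Polynomial K) fun i => by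
        by_cases hj : i = 3
        · subst hj; simp
        · simp [hj]
    simpa [φ] using this
  have hconst : φ f = Polynomial.C ((φ f).coeff 0) := by
    ext k
    rw [Polynomial.coeff_C]
    split_ifs with hk
    · rw [hk]
    · by_contra hk0
      have h1 := hcoeff k hk0
      have h2 := Polynomial.le_natDegree_of_ne_zero hk0
      omega
  have hz := hφ 0
  rw [Pi.single_zero, hconst, Polynomial.eval_C] at hz
  rw [hz, hφ 1, hconst, Polynomial.eval_C, ← hconst]

end LowerBound

/-! ### Realization by the alternating group and its representation. -/

section AlternatingGroup

open Equiv

/-- The double transpositions in the alternating group of degree `4`. -/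
def doubleTransposition : Fin 3 → alternatingGroup (Fin 4) :=
  ![⟨swap 0 1 * swap 2 3, Perm.mem_alternatingGroup.2 (by decide)⟩,
    ⟨swap 1 2 * swap 0 3, Perm.mem_alternatingGroup.2 (by decide)⟩,
    ⟨swap 0 2 * swap 1 3, Perm.mem_alternatingGroup.2 (by decide)⟩]

/-- The cycle `0 ↦ 1 ↦ 2 ↦ 0`. -/
def threeCycle : alternatingGroup (Fin 4) :=
  ⟨swap 0 1 * swap 1 2, Perm.mem_alternatingGroup.2 (by decide)⟩

set_option maxRecDepth 10000 in
theorem alternatingGroup_four_cases : ∀ σ : alternatingGroup (Fin 4), ∃ k : Fin 3,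
    σ = threeCycle ^ (k : ℕ) ∨ ∃ i, σ = threeCycle ^ (k : ℕ) * doubleTransposition i := by
  decide

/-- The generators of `A₄ × C₂` as a wreath product. -/
def altProdGenerators : WreathGenerators (alternatingGroup (Fin 4) × Multiplicative (ZMod 2)) where
  inv i := (doubleTransposition i, Multiplicative.ofAdd 1)
  rot := (threeCycle, 1)
  inv_mul_self i := Prod.ext (by revert i; decide) (by revert i; decide)
  inv_comm i j := Prod.ext (by revert i j; decide) (by revert i j; decide)
  rot_cube := Prod.ext (by decide) (by decide)
  rot_mul_inv i := Prod.ext (by revert i; decide) (by revert i; decide)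
  closure_eq_top := by
    rw [eq_top_iff]
    rintro ⟨σ, e⟩ -
    set H := Subgroup.closure (insert ((threeCycle, 1) : alternatingGroup (Fin 4) ×
      Multiplicative (ZMod 2)) (Set.range fun i => (doubleTransposition i,
        Multiplicative.ofAdd (1 : ZMod 2))))
    have hr : ((threeCycle, 1) : alternatingGroup (Fin 4) × Multiplicative (ZMod 2)) ∈ H :=
      Subgroup.subset_closure (Set.mem_insert _ _)
    have hd (i) : (doubleTransposition i, Multiplicative.ofAdd (1 : ZMod 2)) ∈ H :=
      Subgroup.subset_closure (Set.mem_insert_of_mem _ ⟨i, rfl⟩)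
    have hc : ((1, Multiplicative.ofAdd 1) : alternatingGroup (Fin 4) ×
        Multiplicative (ZMod 2)) ∈ H := by
      -- The three double transpositions multiply to 1, while the third power of the central
      -- involution is itself.
      have h := mul_mem (mul_mem (hd 0) (hd 1)) (hd 2)
      have e : doubleTransposition 0 * doubleTransposition 1 * doubleTransposition 2 = 1 := by
        decide
      simp only [Prod.mk_mul_mk, e] at h
      exact h
    have hce (e : Multiplicative (ZMod 2)) : ((1, e) : alternatingGroup (Fin 4) ×
        Multiplicative (ZMod 2)) ∈ H := by
      rcases zmod_two_cases e.toAdd with h | h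
      · rw [show e = 1 from h]
        exact one_mem H
      · rw [show e = Multiplicative.ofAdd 1 from h]
        exact hc
    obtain ⟨k, rfl | ⟨i, rfl⟩⟩ := alternatingGroup_four_cases σ
    · have h := mul_mem (pow_mem hr k) (hce e)
      simpa using h
    · have h := mul_mem (mul_mem (pow_mem hr k) (hd i)) (hce (Multiplicative.ofAdd 1 * e))
      have h1 : Multiplicative.ofAdd (1 : ZMod 2) * (Multiplicative.ofAdd 1 * e) = e := by
        rw [← mul_assoc, show Multiplicative.ofAdd (1 : ZMod 2) * Multiplicative.ofAdd 1 = 1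
          from rfl, one_mul]
      simpa [h1] using h

/-- The class of a permutation modulo the double transpositions. -/
def cyclicClass (σ : Perm (Fin 4)) : ZMod 3 :=
  -- Addition is modulo 4: the sum identifies the image of the splitting {0,1} | {2,3}, with 1 for
  -- itself, 3 for {1,2} | {0,3}, and 0 or 2 for the third.
  if σ 0 + σ 1 = 1 then 0 else if σ 0 + σ 1 = 3 then 1 else 2

set_option maxRecDepth 10000 in
theorem cyclicClass_mul : ∀ σ τ : alternatingGroup (Fin 4),
    cyclicClass (σ * τ : alternatingGroup (Fin 4)) = cyclicClass σ + cyclicClass τ := by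
  decide

/-- The coordinates of the vertices of a tetrahedron, completed by a zero row. -/
def tetrahedron : Fin 4 → Fin 4 → ℤ :=
  ![![1, 1, -1, -1], ![-1, 1, 1, -1], ![1, -1, 1, -1], 0]

/-- The action of a permutation on the tetrahedron, completed by a zero row and column. -/
def tetraMatrix (σ : Perm (Fin 4)) : Matrix (Fin 4) (Fin 4) ℤ :=
  -- The nonzero rows are orthogonal with square length 4 and are permuted up to sign by `σ`, so the
  -- division is exact.
  fun i j => (∑ k, tetrahedron i (σ k) * tetrahedron j k) / 4

set_option maxRecDepth 10000 in
theorem tetraMatrix_mul : ∀ σ τ : alternatingGroup (Fin 4),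
    tetraMatrix (σ * τ : alternatingGroup (Fin 4)) = tetraMatrix σ * tetraMatrix τ := by
  decide +kernel

theorem tetraMatrix_three_left (σ : Perm (Fin 4)) (j : Fin 4) : tetraMatrix σ 3 j = 0 := by
  simp [tetraMatrix, tetrahedron]

theorem tetraMatrix_three_right (σ : Perm (Fin 4)) (i : Fin 4) : tetraMatrix σ i 3 = 0 := by
  simp [tetraMatrix, tetrahedron]

variable {K : Type*} [Field K]

/-- The matrices of a four-dimensional representation: a signed version of the action on the
tetrahedron plus a character of order `6`. -/
def altProdMatrix (μ : K) (x : alternatingGroup (Fin 4) × Multiplicative (ZMod 2)) :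
    Matrix (Fin 4) (Fin 4) K :=
  sgn K x.2.toAdd • ((tetraMatrix x.1).map (Int.cast : ℤ → K) +
    Matrix.single 3 3 (μ ^ (cyclicClass x.1).val))

theorem altProdMatrix_one (μ : K) : altProdMatrix μ 1 = 1 := by
  have h1 : tetraMatrix (1 : Perm (Fin 4)) = Matrix.diagonal ![1, 1, 1, 0] := by decide
  have h2 : cyclicClass 1 = 0 := by decide
  ext i j
  simp only [altProdMatrix, Prod.fst_one, Subgroup.coe_one, h1, h2, Prod.snd_one, toAdd_one,
    sgn_zero, one_smul, ZMod.val_zero, pow_zero, Matrix.add_apply, Matrix.map_apply]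
  fin_cases i <;> fin_cases j <;> simp [Matrix.single, Matrix.diagonal]

theorem altProdMatrix_mul {μ : K} (hμ : μ ^ 3 = 1)
    (x y : alternatingGroup (Fin 4) × Multiplicative (ZMod 2)) :
    altProdMatrix μ (x * y) = altProdMatrix μ x * altProdMatrix μ y := by
  have hpow : μ ^ (cyclicClass (x.1 * y.1 : alternatingGroup (Fin 4))).val =
      μ ^ (cyclicClass x.1).val * μ ^ (cyclicClass y.1).val := by
    rw [cyclicClass_mul, ZMod.val_add, ← pow_add, ← pow_eq_pow_mod _ hμ]
  have hs : sgn K (x * y).2.toAdd = sgn K x.2.toAdd * sgn K y.2.toAdd := sgn_add _ _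
  have e1 : (tetraMatrix x.1).map (Int.cast : ℤ → K) *
      Matrix.single 3 3 (μ ^ (cyclicClass y.1).val) = 0 := by
    ext i j
    by_cases hj : j = 3
    · subst hj; simp [tetraMatrix_three_right]
    · simp [hj]
  have e2 : Matrix.single 3 3 (μ ^ (cyclicClass x.1).val) *
      (tetraMatrix y.1).map (Int.cast : ℤ → K) = 0 := by
    ext i j
    by_cases hi : i = 3
    · subst hi; simp [tetraMatrix_three_left]
    · simp [hi]
  have e3 : (tetraMatrix (x.1 * y.1 : alternatingGroup (Fin 4))).map (Int.cast : ℤ → K) =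
      (tetraMatrix x.1).map (Int.cast : ℤ → K) * (tetraMatrix y.1).map (Int.cast : ℤ → K) := by
    rw [tetraMatrix_mul]
    exact Matrix.map_mul (f := Int.castRingHom K)
  rw [altProdMatrix, altProdMatrix, altProdMatrix, hs, smul_mul_smul_comm, mul_add, add_mul,
    add_mul, e1, e2, ← e3, Prod.fst_mul, hpow, Matrix.single_mul_single_same, add_zero, zero_add]

/-- The four-dimensional representation with matrices `altProdMatrix μ`. -/
def altProdRep {μ : K} (hμ : μ ^ 3 = 1) :
    alternatingGroup (Fin 4) × Multiplicative (ZMod 2) →* GL (Fin 4) K :=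
  MonoidHom.toHomUnits
    { toFun := altProdMatrix μ
      map_one' := altProdMatrix_one μ
      map_mul' := altProdMatrix_mul hμ }

theorem polyAction_altProdRep {μ : K} (hμ : μ ^ 3 = 1)
    (x : alternatingGroup (Fin 4) × Multiplicative (ZMod 2)) (j : Fin 4) :
    polyAction (altProdRep hμ) x (X j) = ∑ i, C (altProdMatrix μ x⁻¹ j i) * X i :=
  polyAction_X _ _ _

theorem polyAction_altProdRep_inv {μ : K} (hμ : μ ^ 3 = 1) (i : Fin 3) (j : Fin 4) :
    polyAction (altProdRep hμ) (altProdGenerators.inv i) (X j) =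
      C (if j = i.castSucc ∨ j = 3 then -1 else 1) * X j := by
  have hi : (altProdGenerators.inv i)⁻¹ = altProdGenerators.inv i :=
    inv_eq_of_mul_eq_one_left (altProdGenerators.inv_mul_self i)
  have h1 : ∀ i : Fin 3, cyclicClass (doubleTransposition i) = 0 := by decide
  have h2 : ∀ i : Fin 3, tetraMatrix (doubleTransposition i) = Matrix.diagonal
      fun j => if j = i.castSucc then 1 else if j = 3 then 0 else -1 := by decide
  rw [polyAction_altProdRep, hi]
  rw [Finset.sum_eq_single_of_mem j (Finset.mem_univ j)]
  · congr 2
    simp only [altProdMatrix, altProdGenerators, h1, h2, toAdd_ofAdd, sgn_one]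
    fin_cases i <;> fin_cases j <;> simp
  · intro k _ hk
    have e : altProdMatrix μ (altProdGenerators.inv i) j k = 0 := by
      simp only [altProdMatrix, altProdGenerators, h2, Matrix.smul_apply, Matrix.add_apply,
        Matrix.map_apply, Matrix.diagonal_apply_ne' _ hk]
      by_cases hj : j = 3
      · subst hj; simp [Matrix.single_apply_of_col_ne _ _ hk.symm]
      · simp [Ne.symm hj]
    rw [e, C_0, zero_mul]

theorem polyAction_altProdRep_rot {μ : K} (hμ : μ ^ 3 = 1) :
    polyAction (altProdRep hμ) altProdGenerators.rot (X 0) = X 1 ∧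
    polyAction (altProdRep hμ) altProdGenerators.rot (X 1) = X 2 ∧
    polyAction (altProdRep hμ) altProdGenerators.rot (X 2) = X 0 ∧
    polyAction (altProdRep hμ) altProdGenerators.rot (X 3) = C (μ * μ) * X 3 := by
  have h1 : cyclicClass (threeCycle⁻¹ : alternatingGroup (Fin 4)) = 2 := by decide
  have h2 : tetraMatrix (threeCycle⁻¹ : alternatingGroup (Fin 4)) =
    !![0, 1, 0, 0; 0, 0, 1, 0; 1, 0, 0, 0; 0, 0, 0, 0] := by decide
  simp only [polyAction_altProdRep, Fin.sum_univ_four, altProdMatrix, altProdGenerators,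
    Prod.fst_inv, Prod.snd_inv, h1, h2, inv_one, toAdd_one, sgn_zero, one_smul]
  have h3 : μ ^ ZMod.val (2 : ZMod 3) = μ * μ := pow_two μ
  rw [h3]
  simp

end AlternatingGroup

/-- Here `ζ³ = -1` and `ζ² - ζ + 1 = 0`. Characteristic 2 would give `ζ³ = 1`; characteristic 3
would give `(ζ + 1)² = 0`, hence `ζ² = 1`. -/
theorem exists_cubeRoot_of_orderOf_eq_six {K : Type*} [Field K] {ζ : K} (hζ : orderOf ζ = 6) :
    (2 : K) ≠ 0 ∧ (3 : K) ≠ 0 ∧ ζ ^ 2 * ζ ^ 2 + ζ ^ 2 + 1 = 0 := by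
  have h6 : ζ ^ 6 = 1 := hζ ▸ pow_orderOf_eq_one ζ
  have h2 : ζ ^ 2 ≠ 1 := pow_ne_one_of_lt_orderOf (by norm_num) (by omega)
  have h3 : ζ ^ 3 ≠ 1 := pow_ne_one_of_lt_orderOf (by norm_num) (by omega)
  have e3 : ζ ^ 3 = -1 := by
    have : (ζ ^ 3 - 1) * (ζ ^ 3 + 1) = 0 := by linear_combination h6
    exact eq_neg_of_add_eq_zero_left
      ((mul_eq_zero.1 this).resolve_left (sub_ne_zero.2 h3))
  have e : ζ ^ 2 - ζ + 1 = 0 := by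
    have : (ζ + 1) * (ζ ^ 2 - ζ + 1) = 0 := by linear_combination e3
    refine (mul_eq_zero.1 this).resolve_left fun h => h2 ?_
    linear_combination (ζ - 1) * h
  refine ⟨fun h => h3 (by linear_combination e3 - h), fun h => h2 ?_, ?_⟩
  · have : (ζ + 1) * (ζ + 1) = 0 := by linear_combination e + ζ * h
    have h1 := mul_self_eq_zero.1 this
    linear_combination (ζ - 1) * h1
  · linear_combination (ζ ^ 2 + ζ + 1) * e

end InvariantTheory

end

theorem mainTheorem5 {K : Type*} [Field K] (hK : ∃ ζ : K, orderOf ζ = 6) :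
    InvariantTheory.sepNoetherNumber K
        (alternatingGroup (Fin 4) × Multiplicative (ZMod 2)) = 6 ∧
      InvariantTheory.noetherNumber K
        (alternatingGroup (Fin 4) × Multiplicative (ZMod 2)) = 8 := by
  open InvariantTheory in
  obtain ⟨ζ, hζ⟩ := hK
  obtain ⟨h2, h3, hω⟩ := exists_cubeRoot_of_orderOf_eq_six hζ
  have hω3 : (ζ ^ 2) ^ 3 = 1 := by linear_combination (ζ ^ 2 - 1) * hω
  -- The action on coordinates uses the inverse group element, so `rot` scales `X 3` by the square
  -- of `ζ ^ 2`, also a primitive cube root of unity.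
  have hμ : (ζ ^ 2 * ζ ^ 2) * (ζ ^ 2 * ζ ^ 2) + ζ ^ 2 * ζ ^ 2 + 1 = 0 := by
    linear_combination (ζ ^ 2 * ζ ^ 2 - ζ ^ 2 + 1) * hω
  obtain ⟨r0, r1, r2, r3⟩ := polyAction_altProdRep_rot hω3
  refine ⟨le_antisymm ?_ ?_, le_antisymm ?_ ?_⟩
  · exact iSup₂_le fun m ρ => iInf₂_le_of_le 6
      ⟨by norm_num, isSeparating_invariantsLE_six h2 h3 hω altProdGenerators ρ⟩ le_rfl
  · exact le_iSup₂_of_le 4 (altProdRep hω3)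
      (six_le_betaSepRep (polyAction_altProdRep_inv hω3) r0 r1 r2 r3 hμ h2 h3)
  · exact iSup₂_le fun m ρ => iInf₂_le_of_le 8
      ⟨by norm_num, adjoin_invariantsLE_eight h2 h3 altProdGenerators ρ⟩ le_rfl
  · exact le_iSup₂_of_le 4 (altProdRep hω3)
      (eight_le_betaRep (polyAction_altProdRep_inv hω3) r0 r1 r2 r3 hμ h2 h3)
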